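/- Let $M=(M,\phi,\xi,\eta,g)$ be a smooth contact metric manifold of dimension $2n+1$: $\phi$ is a $(1,1)$-tensor field, $\xi$ a vector field, $\eta$ a $1$-form and $g$ a Riemannian metric, all smooth, with $\phi^2X=-X+\eta(X)\xi$, $\phi\xi=0$, $\eta\circ\phi=0$, $\eta(\xi)=1$, $g(\phi X,\phi Y)=g(X,Y)-\eta(X)\eta(Y)$, $\eta(X)=g(\xi,X)$, $\eta\wedge(d\eta)^n\neq0$ everywhere, and $d\eta(X,Y)=g(X,\phi Y)$, where $d\eta(X,Y)=\frac12\big(X\eta(Y)-Y\eta(X)-\eta([X,Y])\big)$. Let $\nabla$ be the Levi-Civita connection of $g$ and $R(X,Y)Z=[\nabla_X,\nabla_Y]Z-\nabla_{[X,Y]}Z$ its curvature tensor. In any local coordinates $(x^1,\dots,x^{2n+1})$ of $M$, write $\partial_i=\partial/\partial x^i$, $g_{ij}=g(\partial_i,\partial_j)$, $(g^{ij})=(g_{ij})^{-1}$, $R_{ijkl}=g(R(\partial_i,\partial_j)\partial_k,\partial_l)$, $\phi\partial_i={\phi_i}^a\partial_a$, $\phi_{ij}=g(\phi\partial_i,\partial_j)$,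 $\eta_i=\eta(\partial_i)$, $\xi=\xi^a\partial_a$, $\nabla^a=g^{ab}\nabla_b$, with summation over repeated indices. Then, at every point and for all indices $i,j,k,l$, \begin{align*} &R_{ijkl}+{\phi_i}^a{\phi_j}^b{\phi_k}^c{\phi_l}^dR_{abcd}+{\phi_i}^a{\phi_k}^cR_{ajcl}+{\phi_j}^b{\phi_l}^dR_{ibkd}-{\phi_i}^a{\phi_j}^bR_{abkl}\\ &\quad-{\phi_k}^c{\phi_l}^dR_{ijcd}+{\phi_i}^a{\phi_l}^dR_{ajkd}+{\phi_j}^b{\phi_k}^cR_{ibcl}+4\phi_{il}\phi_{jk}-4\phi_{jl}\phi_{ik}\\ &\quad-4g_{il}g_{jk}+4g_{jl}g_{ik}+4g_{il}\eta_j\eta_k+4g_{jk}\eta_i\eta_l-4g_{jl}\eta_i\eta_k-4g_{ik}\eta_j\eta_l\\ &=2(\nabla^a\phi_{ij})\nabla_a\phi_{kl}+2\eta_k\nabla_l\phi_{ij}-2\eta_l\nabla_k\phi_{ij}+2\eta_i\nabla_j\phi_{kl}-2\eta_j\nabla_i\phi_{kl}, \end{align*} \begin{align*} &\xi^a{\phi_j}^b{\phi_k}^c{\phi_l}^dR_{abcd}+\xi^a{\phi_k}^cR_{ajcl}-\xi^a{\phi_j}^bR_{abkl}+\xi^a{\phi_l}^dR_{ajkd}\\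 &=2(\nabla^a\eta_j)\nabla_a\phi_{kl}+2\eta_k\nabla_l\eta_j-2\eta_l\nabla_k\eta_j+2\phi_{aj}\nabla^a\phi_{kl}, \end{align*} and \begin{equation*} {\phi_i}^a\xi^b{\phi_k}^c\xi^dR_{abcd}+\xi^b\xi^dR_{ibkd}=2\big((\nabla_a\eta_i)\nabla^a\eta_k+\phi_{ak}\nabla^a\eta_i+\phi_{ai}\nabla^a\eta_k\big). \end{equation*} -/

import Mathlib

open Bundle
open scoped Manifold ContDiff

noncomputable section

/-! ### Tensor calculus in local coordinates

`Coord m` is the model space `ℝ ^ m`. A tensor field written in local coordinates is a family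
of real functions on `Coord m`, indexed by its tensor indices. Throughout, `g i j` are the
components of a Riemannian metric, `θ j` those of a 1-form and `t i j` those of a tensor field
of type (0,2). -/

/-- The coordinate space `ℝ ^ m`. -/
abbrev Coord (m : ℕ) : Type := EuclideanSpace ℝ (Fin m)

namespace Coord

variable {m : ℕ}

/-- The partial derivative `∂ᵢ f` of a function at the point `y`. -/
def partialDeriv (i : Fin m) (f : Coord m → ℝ) (y : Coord m) : ℝ :=
  fderiv ℝ f y (EuclideanSpace.single i 1)

/-- The components `g^{ij}` of the inverse matrix of `(g_{ij})`. -/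
def metricInv (g : Fin m → Fin m → Coord m → ℝ) (i j : Fin m) (y : Coord m) : ℝ :=
  (Matrix.of fun a b => g a b y)⁻¹ i j

/-- The Christoffel symbols of the Levi-Civita connection of `g`,
`∇_{∂ᵢ} ∂ⱼ = ∑ₖ Γᵏᵢⱼ ∂ₖ`, with
`Γᵏᵢⱼ = 1/2 ∑ₗ g^{kl} (∂ᵢ g_{jl} + ∂ⱼ g_{il} - ∂ₗ g_{ij})`;
it is written `christoffel g k i j`. -/
def christoffel (g : Fin m → Fin m → Coord m → ℝ) (k i j : Fin m) (y : Coord m) : ℝ :=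
  (1 / 2 : ℝ) * ∑ l, metricInv g k l y *
    (partialDeriv i (g j l) y + partialDeriv j (g i l) y - partialDeriv l (g i j) y)

/-- The components `R_{ijk}^l` of the curvature tensor
`R(X, Y)Z = ∇_X ∇_Y Z - ∇_Y ∇_X Z - ∇_{[X, Y]} Z`, that is
`R(∂ᵢ, ∂ⱼ)∂ₖ = ∑ₗ R_{ijk}^l ∂ₗ`. -/
def curvatureUp (g : Fin m → Fin m → Coord m → ℝ) (i j k l : Fin m) (y : Coord m) : ℝ :=
  partialDeriv i (christoffel g l j k) y - partialDeriv j (christoffel g l i k) y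
    + ∑ a, (christoffel g l i a y * christoffel g a j k y
      - christoffel g l j a y * christoffel g a i k y)

/-- The components `R_{ijkl} = g(R(∂ᵢ, ∂ⱼ)∂ₖ, ∂ₗ) = ∑_d g_{dl} R_{ijk}^d`
of the curvature tensor of type (0,4). -/
def curvature (g : Fin m → Fin m → Coord m → ℝ) (i j k l : Fin m) (y : Coord m) : ℝ :=
  ∑ d, g d l y * curvatureUp g i j k d y

/-- The components `∇ₐ θⱼ` of the covariant derivative of a 1-form. -/
def covDerivOne (g : Fin m → Fin m → Coord m → ℝ) (θ : Fin m → Coord m → ℝ)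
    (a j : Fin m) (y : Coord m) : ℝ :=
  partialDeriv a (θ j) y - ∑ b, christoffel g b a j y * θ b y

/-- The components `∇ₐ t_{ij}` of the covariant derivative of a tensor of type (0,2). -/
def covDerivTwo (g : Fin m → Fin m → Coord m → ℝ) (t : Fin m → Fin m → Coord m → ℝ)
    (a i j : Fin m) (y : Coord m) : ℝ :=
  partialDeriv a (t i j) y - ∑ b, christoffel g b a i y * t b j y
    - ∑ b, christoffel g b a j y * t i b y

/-- The components `(dθ)(∂ᵢ, ∂ⱼ)` of the exterior derivative of a 1-form, with the normalization
`dθ(X, Y) = 1/2 (X θ(Y) - Y θ(X) - θ([X, Y]))` of contact metric geometry. -/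
def extDerivOne (θ : Fin m → Coord m → ℝ) (i j : Fin m) (y : Coord m) : ℝ :=
  (1 / 2 : ℝ) * (partialDeriv i (θ j) y - partialDeriv j (θ i) y)

/-- Up to a positive factor that depends only on `n`, the component
`(θ ∧ (dθ)ⁿ)(∂₁, …, ∂_{2n+1})` of the top degree form `θ ∧ (dθ)ⁿ`. -/
def contactVolume {n : ℕ} (θ : Fin (2 * n + 1) → Coord (2 * n + 1) → ℝ)
    (y : Coord (2 * n + 1)) : ℝ :=
  ∑ σ : Equiv.Perm (Fin (2 * n + 1)), ((Equiv.Perm.sign σ : ℤ) : ℝ) *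
    (θ (σ 0) y * ∏ k : Fin n,
      extDerivOne θ (σ ⟨2 * (k : ℕ) + 1, by omega⟩) (σ ⟨2 * (k : ℕ) + 2, by omega⟩) y)

end Coord

/-! ### Almost contact metric structures and contact metric structures -/

/-- A smooth almost contact metric structure `(φ, ξ, η, g)` on a smooth manifold `M` of dimension
`2n + 1`: a (1,1)-tensor field `φ`, a vector field `ξ`, a 1-form `η` and a Riemannian metric `g`,
all smooth, with the usual algebraic identities. -/
structure AlmostContactMetricStructure (n : ℕ) (M : Type*) [TopologicalSpace M]
    [ChartedSpace (Coord (2 * n + 1)) M] [IsManifold (𝓡 (2 * n + 1)) ∞ M] where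
  /-- The structure tensor. -/
  φ : ∀ p : M, TangentSpace (𝓡 (2 * n + 1)) p →L[ℝ] TangentSpace (𝓡 (2 * n + 1)) p
  /-- The characteristic vector field. -/
  ξ : ∀ p : M, TangentSpace (𝓡 (2 * n + 1)) p
  /-- The 1-form. -/
  η : ∀ p : M, TangentSpace (𝓡 (2 * n + 1)) p →L[ℝ] ℝ
  /-- The smooth Riemannian metric. -/
  g : ContMDiffRiemannianMetric (𝓡 (2 * n + 1)) ∞ (Coord (2 * n + 1))
    (fun p : M => TangentSpace (𝓡 (2 * n + 1)) p)
  φ_smooth : ContMDiff (𝓡 (2 * n + 1))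
    ((𝓡 (2 * n + 1)).prod 𝓘(ℝ, Coord (2 * n + 1) →L[ℝ] Coord (2 * n + 1))) ∞
    (fun p => TotalSpace.mk' (Coord (2 * n + 1) →L[ℝ] Coord (2 * n + 1))
      (E := fun p : M => TangentSpace (𝓡 (2 * n + 1)) p →L[ℝ] TangentSpace (𝓡 (2 * n + 1)) p)
      p (φ p))
  ξ_smooth : ContMDiff (𝓡 (2 * n + 1)) ((𝓡 (2 * n + 1)).prod 𝓘(ℝ, Coord (2 * n + 1))) ∞
    (fun p => TotalSpace.mk' (Coord (2 * n + 1))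
      (E := fun p : M => TangentSpace (𝓡 (2 * n + 1)) p) p (ξ p))
  η_smooth : ContMDiff (𝓡 (2 * n + 1))
    ((𝓡 (2 * n + 1)).prod 𝓘(ℝ, Coord (2 * n + 1) →L[ℝ] ℝ)) ∞
    (fun p => TotalSpace.mk' (Coord (2 * n + 1) →L[ℝ] ℝ)
      (E := fun p : M => TangentSpace (𝓡 (2 * n + 1)) p →L[ℝ] Trivial M ℝ p)
      p (η p))
  φ_φ : ∀ (p : M) (X : TangentSpace (𝓡 (2 * n + 1)) p), φ p (φ p X) = -X + η p X • ξ p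
  φ_ξ : ∀ p : M, φ p (ξ p) = 0
  η_φ : ∀ (p : M) (X : TangentSpace (𝓡 (2 * n + 1)) p), η p (φ p X) = 0
  η_ξ : ∀ p : M, η p (ξ p) = 1
  g_φ_φ : ∀ (p : M) (X Y : TangentSpace (𝓡 (2 * n + 1)) p),
    g.inner p (φ p X) (φ p Y) = g.inner p X Y - η p X * η p Y
  g_ξ : ∀ (p : M) (X : TangentSpace (𝓡 (2 * n + 1)) p), η p X = g.inner p (ξ p) X

namespace AlmostContactMetricStructure

variable {n : ℕ} {M : Type*} [TopologicalSpace M]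
  [ChartedSpace (Coord (2 * n + 1)) M] [IsManifold (𝓡 (2 * n + 1)) ∞ M]

/-- The coordinate vector `∂ᵢ` of the chart `e` at the point of `M` with coordinates `y`. -/
def coordVec (e : OpenPartialHomeomorph M (Coord (2 * n + 1))) (i : Fin (2 * n + 1))
    (y : Coord (2 * n + 1)) : TangentSpace (𝓡 (2 * n + 1)) (e.symm y) :=
  mfderiv 𝓘(ℝ, Coord (2 * n + 1)) (𝓡 (2 * n + 1)) e.symm y (EuclideanSpace.single i (1 : ℝ))

/-- The `i`-th component `dxⁱ(v)` of a tangent vector `v` in the chart `e`. -/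
def coordComp (e : OpenPartialHomeomorph M (Coord (2 * n + 1))) (i : Fin (2 * n + 1))
    {p : M} (v : TangentSpace (𝓡 (2 * n + 1)) p) : ℝ :=
  (show Coord (2 * n + 1) from
    mfderiv (𝓡 (2 * n + 1)) 𝓘(ℝ, Coord (2 * n + 1)) e p v) i

variable (S : AlmostContactMetricStructure n M) (e : OpenPartialHomeomorph M (Coord (2 * n + 1)))

/-- `g_{ij} = g(∂ᵢ, ∂ⱼ)`. -/
def gLow (i j : Fin (2 * n + 1)) (y : Coord (2 * n + 1)) : ℝ :=
  S.g.inner (e.symm y) (coordVec e i y) (coordVec e j y)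

/-- `ηᵢ = η(∂ᵢ)`. -/
def ηLow (i : Fin (2 * n + 1)) (y : Coord (2 * n + 1)) : ℝ :=
  S.η (e.symm y) (coordVec e i y)

/-- `φ_{ij} = g(φ ∂ᵢ, ∂ⱼ)`. -/
def φLow (i j : Fin (2 * n + 1)) (y : Coord (2 * n + 1)) : ℝ :=
  S.g.inner (e.symm y) (S.φ (e.symm y) (coordVec e i y)) (coordVec e j y)

/-- `φᵢᵃ`, where `φ ∂ᵢ = ∑ₐ φᵢᵃ ∂ₐ`. -/
def φUp (i a : Fin (2 * n + 1)) (y : Coord (2 * n + 1)) : ℝ :=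
  coordComp e a (S.φ (e.symm y) (coordVec e i y))

/-- `ξᵃ`, where `ξ = ∑ₐ ξᵃ ∂ₐ`. -/
def ξUp (a : Fin (2 * n + 1)) (y : Coord (2 * n + 1)) : ℝ :=
  coordComp e a (S.ξ (e.symm y))

/-- `g^{ij}`, the inverse matrix of `(g_{ij})`. -/
def gUp (i j : Fin (2 * n + 1)) (y : Coord (2 * n + 1)) : ℝ :=
  Coord.metricInv (S.gLow e) i j y

/-- `R_{ijkl} = g(R(∂ᵢ, ∂ⱼ)∂ₖ, ∂ₗ)`, the curvature tensor of the Levi-Civita connection of `g`. -/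
def R (i j k l : Fin (2 * n + 1)) (y : Coord (2 * n + 1)) : ℝ :=
  Coord.curvature (S.gLow e) i j k l y

/-- `∇ₐ φ_{ij}`. -/
def nablaφ (a i j : Fin (2 * n + 1)) (y : Coord (2 * n + 1)) : ℝ :=
  Coord.covDerivTwo (S.gLow e) (S.φLow e) a i j y

/-- `∇ₐ ηⱼ`. -/
def nablaη (a j : Fin (2 * n + 1)) (y : Coord (2 * n + 1)) : ℝ :=
  Coord.covDerivOne (S.gLow e) (S.ηLow e) a j y

/-- `∇ᵃ φ_{ij} = ∑_b g^{ab} ∇_b φ_{ij}`. -/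
def nablaUpφ (a i j : Fin (2 * n + 1)) (y : Coord (2 * n + 1)) : ℝ :=
  ∑ b, S.gUp e a b y * S.nablaφ e b i j y

/-- `∇ᵃ ηⱼ = ∑_b g^{ab} ∇_b ηⱼ`. -/
def nablaUpη (a j : Fin (2 * n + 1)) (y : Coord (2 * n + 1)) : ℝ :=
  ∑ b, S.gUp e a b y * S.nablaη e b j y

/-- The almost contact metric structure `(φ, ξ, η, g)` is a contact metric structure: `η` is a
contact form, `η ∧ (dη)ⁿ ≠ 0` everywhere, and `dη(X, Y) = g(X, φ Y)`. Both conditions are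
written in all the local coordinate systems of the smooth manifold. -/
structure IsContactMetric : Prop where
  contact : ∀ e ∈ IsManifold.maximalAtlas (𝓡 (2 * n + 1)) ∞ M, ∀ y ∈ e.target,
    Coord.contactVolume (S.ηLow e) y ≠ 0
  dη_eq : ∀ e ∈ IsManifold.maximalAtlas (𝓡 (2 * n + 1)) ∞ M, ∀ y ∈ e.target,
    ∀ i j : Fin (2 * n + 1), Coord.extDerivOne (S.ηLow e) i j y =
      S.g.inner (e.symm y) (coordVec e i y) (S.φ (e.symm y) (coordVec e j y))

end AlmostContactMetricStructure

end

/-! Fix a point and write N = ∇ξ and t = ∇φ. Differentiating the algebraic relations, together with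
dη(X,Y) = g(X,φY) and the closedness of dη, gives strong first-order constraints: φN + Nφ = 2(1 -
η⊗ξ), φN is symmetric, ∇_ξ φ = 0, and above all `t_φ_left`, which expresses t(φX)Y + φ(t X Y)
through N, φ, ξ and g alone. This is the contact counterpart of the quasi-Kähler condition.

Since these constraints hold at every point of an open set, they may be differentiated once more.
The derivative of `t_φ_left` shows that a certain sum of four components of ∇²φ is of lower order,
apart from terms η(l)∇²ξ (`D_combination`). Alternating that sum in i, j turns the second
derivatives into commutators, and the Ricci identity for φ turns these into the eight curvature
terms of the first identity; the terms with ∇²ξ cancel. What remains is quadratic in ∇φ, and `t_eq`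
identifies it with the contraction of ∇φ with itself: by closedness, raising the derivative index of
∇φ gives the vector t Z Y - t Y Z. The second identity comes from the same Ricci identity with first
argument ξ, where φξ = 0 and ∇_ξ φ = 0 shorten the computation; the third comes from the Ricci
identity for ξ.

The rest is transport. Covariant derivatives on an open subset of a normed space are handled by
testing on fields that are parallel at one point. A chart carries the structure on M to such an open
set, and contractions over indices become evaluations of multilinear maps. -/

noncomputable section

/-! ### First-order algebra at a point. -/

/-- The first covariant derivatives `N = ∇ξ` and `t = ∇φ` of a contact metric structure
`(φ, ξ, g)` at a point, with the identities they satisfy. -/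
structure IsContactJet {E : Type*} [NormedAddCommGroup E] [NormedSpace ℝ E]
    (g : E →L[ℝ] E →L[ℝ] ℝ) (φ : E →L[ℝ] E) (ξ : E) (N : E →L[ℝ] E)
    (t : E →L[ℝ] E →L[ℝ] E) : Prop where
  symm : ∀ X Y, g X Y = g Y X
  nondeg : ∀ X, (∀ Z, g X Z = 0) → X = 0
  φφ : ∀ X, φ (φ X) = -X + g ξ X • ξ
  φξ : φ ξ = 0
  ξξ : g ξ ξ = 1
  skew : ∀ X Y, g (φ X) Y = -g X (φ Y)
  dη : ∀ X Y, g (N X) Y - g (N Y) X = 2 * g X (φ Y)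
  ξN : ∀ X, g ξ (N X) = 0
  t_skew : ∀ X Y Z, g (t X Y) Z = -g Y (t X Z)
  t_cyc : ∀ X Y Z, g (t X Y) Z + g (t Y Z) X + g (t Z X) Y = 0
  t_φ : ∀ X Y, t X (φ Y) + φ (t X Y) = g (N X) Y • ξ + g ξ Y • N X
  t_ξ : ∀ X, t X ξ = -φ (N X)

namespace IsContactJet

variable {E : Type*} [NormedAddCommGroup E] [NormedSpace ℝ E]
  {g : E →L[ℝ] E →L[ℝ] ℝ} {φ : E →L[ℝ] E} {ξ : E} {N : E →L[ℝ] E} {t : E →L[ℝ] E →L[ℝ] E}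

theorem ext_right (h : IsContactJet g φ ξ N t) {X Y : E} (H : ∀ Z, g X Z = g Y Z) : X = Y :=
  sub_eq_zero.1 (h.nondeg _ fun Z => by simp [H Z])

theorem ξφ (h : IsContactJet g φ ξ N t) (X : E) : g ξ (φ X) = 0 := by
  have := h.skew ξ X
  rw [h.φξ] at this
  simpa using this

theorem φ_φ (h : IsContactJet g φ ξ N t) (X Y : E) :
    g (φ X) (φ Y) = g X Y - g ξ X * g ξ Y := by
  have := h.skew X (φ Y)
  rw [h.φφ] at this
  simp only [map_add, map_neg, map_smul, smul_eq_mul] at this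
  rw [this, h.symm X ξ]; ring

/-- The field ξ has constant length and lies in the kernel of dη, so its integral curves are
geodesics. -/
theorem Nξ (h : IsContactJet g φ ξ N t) : N ξ = 0 := by
  refine h.nondeg _ fun Z => ?_
  have h1 := h.dη Z ξ
  have h2 := h.ξN Z
  rw [h.symm] at h2
  rw [h.φξ] at h1
  simp at h1
  linarith

theorem Nξ_right (h : IsContactJet g φ ξ N t) (X : E) : g (N X) ξ = 0 := by
  rw [h.symm, h.ξN]

/-- The transpose of `N` is `N + 2 φ`. -/
theorem N_transpose (h : IsContactJet g φ ξ N t) (X Y : E) :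
    g X (N Y) = g (N X + (2 : ℝ) • φ X) Y := by
  have h1 := h.dη X Y
  have h2 := h.symm X (N Y)
  have h3 := h.skew X Y
  simp only [map_add, map_smul, add_apply, smul_apply, smul_eq_mul]
  linarith

theorem t_φ_scalar (h : IsContactJet g φ ξ N t) (X Y Z : E) :
    g (t X (φ Y)) Z = g (t X Y) (φ Z) + g (N X) Y * g ξ Z + g ξ Y * g (N X) Z := by
  have h1 := congrArg (fun v => g v Z) (h.t_φ X Y)
  have h2 := h.skew (t X Y) Z
  simp only [map_add, map_smul, add_apply, smul_apply, smul_eq_mul] at h1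
  linarith

theorem ξt (h : IsContactJet g φ ξ N t) (X Y : E) : g ξ (t X Y) = g (φ (N X)) Y := by
  have h1 := h.t_skew X ξ Y
  rw [h.t_ξ] at h1
  simp at h1
  linarith

/-- The cyclic identity with one entry ξ. The right side vanishes once φN is known to be symmetric,
but that symmetry is itself derived from this formula through `φN_φ`. -/
theorem t_ξ_left_aux (h : IsContactJet g φ ξ N t) (Y Z : E) :
    g (t ξ Y) Z = g (φ (N Z)) Y - g (φ (N Y)) Z := by
  have h1 := h.t_cyc ξ Y Z
  have h2 := h.ξt Y Z
  rw [h.symm] at h2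
  rw [h.t_ξ Z] at h1
  simp at h1
  linarith

theorem t_swap (h : IsContactJet g φ ξ N t) (X Y Z : E) : g (t X Y) Z = -g (t X Z) Y := by
  rw [h.t_skew, h.symm]

/-- Closedness of dη isolates the direction of differentiation. This gives the raised derivative ∇^a
φ_{ij} as an explicit vector, so no trace over a frame is needed. -/
theorem t_eq (h : IsContactJet g φ ξ N t) (X Y Z : E) : g (t X Y) Z = g X (t Z Y - t Y Z) := by
  have h1 := h.t_cyc X Y Z
  have h2 := h.t_skew Z X Y
  have h3 := h.symm X (t Y Z)
  rw [map_sub]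
  linear_combination h1 - h2 + h3

/-- The derivative of φ² in the direction ξ is zero because Nξ = 0. Inserting the formula for ∇_ξ φ
from the cyclic identity leaves a relation on N alone, which dη at (X, Z) and at (φX, φZ) resolves.
-/
theorem φN_φ (h : IsContactJet g φ ξ N t) (X : E) :
    φ (N (φ X)) = N X + (2 : ℝ) • φ X := by
  refine h.ext_right fun Z => ?_
  have h1 := h.t_φ_scalar ξ X Z
  rw [h.t_ξ_left_aux, h.t_ξ_left_aux, h.Nξ] at h1
  have h2 := h.φ_φ (N Z) X
  have h3 := h.φ_φ (N X) Z
  rw [h.ξN] at h2 h3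
  have h4 := h.dη X Z
  have h5 := h.dη (φ X) (φ Z)
  rw [h.φφ] at h5
  have h6 := h.skew (N (φ X)) Z
  have h7 := h.skew (N (φ Z)) X
  have h8 := h.skew X Z
  have h9 := h.symm (φ X) ξ
  have h10 := h.ξφ X
  simp only [map_zero, map_add, map_neg, map_smul, add_apply, smul_apply, smul_eq_mul, zero_apply, zero_mul,
    mul_zero, h9, h10] at *
  linarith

/-- Obtained by applying φ to `φN_φ`. In the usual notation N = -φ - φh, it says that h anticommutes
with φ. -/
theorem φN_add_Nφ (h : IsContactJet g φ ξ N t) (X : E) :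
    φ (N X) + N (φ X) = (2 : ℝ) • (X - g ξ X • ξ) := by
  have h1 := congrArg φ (h.φN_φ X)
  rw [h.φφ, h.ξN, map_add, map_smul, h.φφ] at h1
  rw [zero_smul, add_zero] at h1
  linear_combination (norm := module) (-1 : ℝ) • h1

theorem Nφ_scalar (h : IsContactJet g φ ξ N t) (X Y : E) :
    g (N (φ X)) Y = 2 * g X Y - 2 * g ξ X * g ξ Y - g (φ (N X)) Y := by
  have h1 := congrArg (fun v => g v Y) (h.φN_add_Nφ X)
  simp only [map_add, map_smul, map_sub, add_apply, sub_apply, smul_apply, smul_eq_mul] at h1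
  linear_combination h1

/-- `φ ∘ N` is symmetric. -/
theorem φN_symm (h : IsContactJet g φ ξ N t) (X Y : E) : g (φ (N X)) Y = g (φ (N Y)) X := by
  have h1 := congrArg (fun v => g v Y) (h.φN_add_Nφ X)
  have h2 := h.dη (φ X) Y
  have h3 := h.φ_φ X Y
  have h4 := h.skew (N Y) X
  simp only [map_add, map_smul, map_sub, add_apply, sub_apply, smul_apply, smul_eq_mul] at h1
  linarith

theorem t_ξ_left (h : IsContactJet g φ ξ N t) (Y : E) : t ξ Y = 0 := by
  refine h.nondeg _ fun Z => ?_
  rw [h.t_ξ_left_aux, h.φN_symm, sub_self]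

/-- Let A(X,Y,Z) be the sum of the first two terms. The cyclic identity at (X,Y,Z) and at (φX,φY,Z)
reduces the part of A alternating in X, Y to derivatives in the direction Z, which the derivative of
φ² cancels up to terms in N. -/
theorem t_add_t_φ_φ_symm (h : IsContactJet g φ ξ N t) (X Y Z : E) :
    g (t X Y) Z + g (t (φ X) (φ Y)) Z - (g (t Y X) Z + g (t (φ Y) (φ X)) Z) =
      g ξ X * g (φ (N Z)) Y - g ξ Y * g (φ (N Z)) X := by
  have h1 := h.t_cyc (φ X) (φ Y) Z
  have h2 := h.t_cyc X Y Z
  have h3 := h.t_φ_scalar Z X (φ Y)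
  have h4 := h.t_skew (φ Y) Z (φ X)
  have h5 := h.t_skew Y Z X
  have h6 := h.symm Z (t (φ Y) (φ X))
  have h7 := h.symm Z (t Y X)
  have h8 := h.ξt Z X
  have h9 := h.symm ξ (t Z X)
  have h10 := h.skew (N Z) Y
  rw [h.φφ, h.ξφ] at h3
  simp only [map_add, map_neg, map_smul, smul_eq_mul, mul_zero] at h3
  linear_combination h1 - h4 + h6 - h3 + h2 - h5 + h7 - g ξ Y * (h8 - h9) - g ξ X * h10

/-- The part of A symmetric in Y, Z: skewness of t X leaves only the terms by which φ and t(φX) fail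
to anticommute. -/
theorem t_add_t_φ_φ_skew (h : IsContactJet g φ ξ N t) (X Y Z : E) :
    g (t X Y) Z + g (t (φ X) (φ Y)) Z + (g (t X Z) Y + g (t (φ X) (φ Z)) Y) =
      g (N (φ X)) Y * g ξ Z + g ξ Y * g (N (φ X)) Z := by
  have h1 := h.t_φ_scalar (φ X) Y Z
  have h2 := h.t_skew X Y Z
  have h3 := h.t_skew (φ X) (φ Z) Y
  have h4 := h.symm Y (t X Z)
  have h5 := h.symm (φ Z) (t (φ X) Y)
  linarith

/-- A trilinear form is determined by its alternating part in the first two slots and its symmetric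
part in the last two. The solution is the six-term combination that also yields the Koszul formula.
-/
theorem t_add_t_φ_φ (h : IsContactJet g φ ξ N t) (X Y Z : E) :
    g (t X Y) Z + g (t (φ X) (φ Y)) Z =
      2 * g X Y * g ξ Z - g ξ Y * (g (φ (N X)) Z + 2 * g ξ X * g ξ Z) := by
  have h1 := h.t_add_t_φ_φ_symm X Y Z
  have h2 := h.t_add_t_φ_φ_symm Y Z X
  have h3 := h.t_add_t_φ_φ_symm Z X Y
  have h4 := h.t_add_t_φ_φ_skew X Y Z
  have h5 := h.t_add_t_φ_φ_skew Y Z X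
  have h6 := h.t_add_t_φ_φ_skew Z X Y
  rw [h.Nφ_scalar, h.Nφ_scalar] at h4 h5 h6
  rw [h.φN_symm Z X, h.φN_symm Z Y] at h1
  rw [h.φN_symm Y X] at h3
  rw [h.φN_symm Z X, h.φN_symm Y X, h.symm Y X, h.symm Z X] at *
  linear_combination (h1 - h2 + h3 + h4 + h5 - h6) / 2 -
    g ξ X / 2 * h.φN_symm Y Z + g ξ X * h.symm Y Z

/-- The analogue of the quasi-Kähler identity for contact metric structures. -/
theorem t_φ_left (h : IsContactJet g φ ξ N t) (X Y : E) :
    t (φ X) Y + φ (t X Y) = (g (N X) Y + 2 * g (φ X) Y) • ξ - (2 * g ξ Y) • φ X := by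
  refine h.ext_right fun Z => ?_
  -- With φY in the second slot, φ² turns the second term into -t(φX)Y plus a multiple of t(φX)ξ;
  -- `t_φ_scalar` then moves φ out of the first term.
  have h1 := h.t_add_t_φ_φ X (φ Y) Z
  rw [h.φφ, h.ξφ] at h1
  have h2 := h.t_φ_scalar X Y Z
  have h3 := h.skew (t X Y) Z
  have h4 := h.skew X Y
  have h5 := congrArg (fun v => g v Z) (h.t_ξ (φ X))
  have h6 := congrArg (fun v => g v Z) (h.φN_φ X)
  simp only [map_add, map_neg, map_smul, map_sub, add_apply, sub_apply, neg_apply, smul_apply,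
    smul_eq_mul, zero_mul] at *
  linear_combination h2 + h3 - h1 + g ξ Y * (h5-h6) - 2 * g ξ Z * h4

theorem t_φ_left_φ (h : IsContactJet g φ ξ N t) (X Y Z : E) :
    g (t (φ X) Y) (φ Z) = -g (t X Y) Z + g ξ Z * g (φ (N X)) Y
      - 2 * g ξ Y * (g X Z - g ξ X * g ξ Z) := by
  have h1 := congrArg (fun v => g v (φ Z)) (h.t_φ_left X Y)
  have h2 := h.φ_φ (t X Y) Z
  have h3 := h.φ_φ X Z
  have h4 := h.ξt X Y
  have h5 := h.ξφ Z
  simp only [map_add, map_smul, map_sub, add_apply, sub_apply, smul_apply,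
    smul_eq_mul, h5, h2, h3, h4, mul_zero] at h1
  linear_combination h1

end IsContactJet

/-! ### Second-order algebra and the three curvature identities at a point. -/

/-- The second covariant derivatives `D = ∇²φ` and `F = ∇²ξ` and the curvature operator `R` of a
contact metric structure at a point, with the identities they satisfy. -/
structure IsContactTwoJet {E : Type*} [NormedAddCommGroup E] [NormedSpace ℝ E]
    (g : E →L[ℝ] E →L[ℝ] ℝ) (φ : E →L[ℝ] E) (ξ : E) (N : E →L[ℝ] E)
    (t : E →L[ℝ] E →L[ℝ] E) (D : E → E → E → E) (F : E → E → E) (R : E → E → E → E) : Prop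
    extends IsContactJet g φ ξ N t where
  D_φ : ∀ m X Y, D m (φ X) Y + t (t m X) Y + (t m (t X Y) + φ (D m X Y)) =
    (g (F m X) Y + 2 * g (t m X) Y) • ξ + (g (N X) Y + 2 * g (φ X) Y) • N m
      - ((2 * g (N m) Y) • φ X + (2 * g ξ Y) • t m X)
  ξD : ∀ m X Y, g (N m) (t X Y) + g ξ (D m X Y) = g (t m (N X)) Y + g (φ (F m X)) Y
  φF : ∀ m X, t m (N X) + φ (F m X) + (F m (φ X) + N (t m X)) =
    -(2 : ℝ) • (g (N m) X • ξ + g ξ X • N m)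
  D_ξ : ∀ m Y, D m ξ Y = -t (N m) Y
  F_ξ : ∀ m, F m ξ = -N (N m)
  ξF : ∀ m X, g ξ (F m X) = -g (N m) (N X)
  ricci_φ : ∀ X Y Z, D X Y Z - D Y X Z = R X Y (φ Z) - φ (R X Y Z)
  ricci_ξ : ∀ X Y, F X Y - F Y X = R X Y ξ
  R_skew : ∀ X Y Z W, g (R X Y Z) W = -g (R X Y W) Z

namespace IsContactTwoJet

variable {E : Type*} [NormedAddCommGroup E] [NormedSpace ℝ E]
  {g : E →L[ℝ] E →L[ℝ] ℝ} {φ : E →L[ℝ] E} {ξ : E} {N : E →L[ℝ] E} {t : E →L[ℝ] E →L[ℝ] E}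
  {D : E → E → E → E} {F : E → E → E} {R : E → E → E → E}

theorem D_φ_scalar (h : IsContactTwoJet g φ ξ N t D F R) (m X k l : E) :
    g (D m (φ X) k) l = g (D m X k) (φ l) - g (t (t m X) k) l - g (t m (t X k)) l
      + (g (F m X) k + 2 * g (t m X) k) * g ξ l + (g (N X) k + 2 * g (φ X) k) * g (N m) l
      - 2 * g (N m) k * g (φ X) l - 2 * g ξ k * g (t m X) l := by
  have h1 := congrArg (fun v => g v l) (h.D_φ m X k)
  have h2 := h.skew (D m X k) l
  simp only [map_add, map_smul, map_sub, add_apply, sub_apply, smul_apply, smul_eq_mul] at h1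
  linear_combination h1 - h2

/-- Replacing l by φl produces φ²l and hence a ξ-component of ∇²φ, which `ξD` trades for ∇²ξ. -/
theorem D_φ_φ_scalar (h : IsContactTwoJet g φ ξ N t D F R) (m X k l : E) :
    g (D m (φ X) k) (φ l) = -g (D m X k) l - g (t (t m X) k) (φ l) - g (t m (t X k)) (φ l)
      + (g (N X) k + 2 * g (φ X) k) * g (N m) (φ l)
      - 2 * g (N m) k * (g X l - g ξ X * g ξ l) - 2 * g ξ k * g (t m X) (φ l)
      + g ξ l * (g (t m (N X)) k + g (φ (F m X)) k - g (N m) (t X k)) := by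
  have h1 := h.D_φ_scalar m X k (φ l)
  have h2 := h.ξD m X k
  have h3 := h.symm (D m X k) ξ
  rw [h.φφ, h.ξφ, h.φ_φ] at h1
  simp only [map_add, map_neg, map_smul, smul_eq_mul] at h1
  linear_combination h1 + g ξ l * (h2 + h3)

theorem ricci_φ_scalar (h : IsContactTwoJet g φ ξ N t D F R) (X Y Z W : E) :
    g (R X Y (φ Z)) W + g (R X Y Z) (φ W) = g (D X Y Z) W - g (D Y X Z) W := by
  have h1 := congrArg (fun v => g v W) (h.ricci_φ X Y Z)
  have h2 := h.skew (R X Y Z) W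
  simp only [map_sub, sub_apply] at h1
  linear_combination -h1 + h2

/-- Here φ²W leaves the curvature component with last entry ξ; the Ricci identity for ξ rewrites it
as a commutator of ∇²ξ. -/
theorem ricci_φ_φ_scalar (h : IsContactTwoJet g φ ξ N t D F R) (X Y Z W : E) :
    g (R X Y (φ Z)) (φ W) = g (R X Y Z) W + g ξ W * (g (F X Y) Z - g (F Y X) Z)
      + g (D X Y Z) (φ W) - g (D Y X Z) (φ W) := by
  have h1 := h.ricci_φ_scalar X Y Z (φ W)
  have h2 := congrArg (fun v => g v Z) (h.ricci_ξ X Y)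
  have h3 := h.R_skew X Y Z ξ
  rw [h.φφ] at h1
  simp only [map_add, map_neg, map_smul, smul_eq_mul, map_sub, sub_apply] at h1 h2
  linear_combination h1 - g ξ W * (h3 + h2)

/-- The four terms pair off as in the differentiated `t_φ_left`: those in direction i cancel to
lower order, and so do those in direction φi. Only the terms η(l)∇²ξ remain of second order. -/
theorem D_combination (h : IsContactTwoJet g φ ξ N t D F R) (i j k l : E) :
    g (D i (φ j) k) l - g (D i j k) (φ l) + g (D (φ i) j k) l + g (D (φ i) (φ j) k) (φ l) =
      -2 * g (t (t i j) k) l - 2 * g ξ k * g (t i j) l - 2 * g ξ j * g (t i k) l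
      - 2 * (g (N j) k + 2 * g (φ j) k) * g (φ i) l - 2 * g (N i) k * g (φ j) l
      + 2 * g (φ (N j)) k * g i l + 2 * g (φ (N i)) k * g j l - 4 * g i k * g j l
      + 4 * g ξ i * g ξ k * g j l
      + g ξ l * (g (F i j) k - g (F (φ i) (φ j)) k + 4 * g (t i j) k - 2 * g (t j k) i
        + 4 * g ξ j * g i k - 4 * g ξ k * g i j) := by
  rw [h.D_φ_scalar, h.D_φ_φ_scalar]
  have h1 := h.t_φ_left_φ i (t j k) l
  have h2 := congrArg (fun v => g (t v k) (φ l)) (h.t_φ_left i j)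
  have h3 := h.t_φ_left_φ (t i j) k l
  have h4 := h.t_φ_left_φ i k l
  have h5 := h.t_φ_left_φ i j l
  have h6 := congrArg (fun v => g v k) (h.φF (φ i) j)
  have h7 := congrArg (fun v => g (N v) k) (h.t_φ_left i j)
  have h8 := h.Nφ_scalar (t i j) k
  have h9 := h.Nφ_scalar i k
  have h10 := h.Nφ_scalar i (t j k)
  have h11 := h.symm i (t j k)
  have h12 := h.ξt j k
  have h13 := h.ξt i j
  have h14 := congrArg (fun v => g v l) (h.φN_φ i)
  have h15 := h.skew (N (φ i)) l
  have h16 := h.Nφ_scalar i j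
  simp only [map_add, map_smul, map_sub, add_apply, sub_apply, smul_apply,
    smul_eq_mul, h.t_ξ_left, h.Nξ, map_zero, zero_apply, mul_zero, h12, h13]
    at h1 h2 h3 h4 h5 h6 h7 h8 h9 h10 h14 h15 h16
  linear_combination - h1 - h2 + h3 + 2 * g ξ j * h4 - 2 * g ξ k * h5 + g ξ l * (h6 - h7 + h8)
    - 2 * g ξ l * g ξ k * h16 + 2 * g ξ l * g ξ j * h9 - g ξ l * h10 - 2 * g ξ l * h11
    + (g (N j) k + 2 * g (φ j) k) * (h15 - h14) - 2 * g j l * h9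

set_option maxHeartbeats 1000000 in
/-- The curvature identity for four arbitrary vectors. -/
theorem curvature_identity (h : IsContactTwoJet g φ ξ N t D F R) (i j k l : E) :
    g (R i j k) l + g (R (φ i) (φ j) (φ k)) (φ l) + g (R (φ i) j (φ k)) l
      + g (R i (φ j) k) (φ l) - g (R (φ i) (φ j) k) l - g (R i j (φ k)) (φ l)
      + g (R (φ i) j k) (φ l) + g (R i (φ j) (φ k)) l
      + 4 * g (φ i) l * g (φ j) k - 4 * g (φ j) l * g (φ i) k - 4 * g i l * g j k
      + 4 * g j l * g i k + 4 * g i l * g ξ j * g ξ k + 4 * g j k * g ξ i * g ξ l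
      - 4 * g j l * g ξ i * g ξ k - 4 * g i k * g ξ j * g ξ l =
    2 * g (t j i - t i j) (t l k - t k l) + 2 * g ξ k * g (t l i) j - 2 * g ξ l * g (t k i) j
      + 2 * g ξ i * g (t j k) l - 2 * g ξ j * g (t i k) l := by
  have h1 := h.D_combination i j k l
  have h2 := h.D_combination j i k l
  have h3 := h.ricci_φ_φ_scalar i j k l
  have h4 := h.ricci_φ_φ_scalar (φ i) (φ j) k l
  have h5 := h.ricci_φ_scalar (φ i) j k l
  have h6 := h.ricci_φ_scalar i (φ j) k l
  have h7 := h.t_eq (t i j) k l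
  have h8 := h.t_eq (t j i) k l
  have h11 := h.t_cyc i j l
  have h12 := h.t_cyc i j k
  have h13 := h.t_swap j l i
  have h14 := h.t_swap j k i
  have h9 := h.t_swap i k j
  have h16 := h.symm i j
  simp only [map_sub, sub_apply] at h7 h8 ⊢
  -- The eight curvature terms group into four Ricci commutators, whose sum is the alternation in i,
  -- j of the expression in `D_combination`.
  have h17 : g (R i j k) l + g (R (φ i) (φ j) (φ k)) (φ l) + g (R (φ i) j (φ k)) l
      + g (R i (φ j) k) (φ l) - g (R (φ i) (φ j) k) l - g (R i j (φ k)) (φ l)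
      + g (R (φ i) j k) (φ l) + g (R i (φ j) (φ k)) l =
      g (D i (φ j) k) l - g (D i j k) (φ l) + g (D (φ i) j k) l + g (D (φ i) (φ j) k) (φ l) -
      (g (D j (φ i) k) l - g (D j i k) (φ l) + g (D (φ j) i k) l + g (D (φ j) (φ i) k) (φ l)) -
      g ξ l * (g (F i j) k - g (F j i) k - g (F (φ i) (φ j)) k + g (F (φ j) (φ i)) k) := by
    linear_combination h4 + h5 + h6 - h3
  -- The terms η(l)∇²ξ from `h17` and from the two uses of `D_combination` cancel, while `h7` and
  -- `h8` supply the quadratic term in ∇φ.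
  rw [h17, h1, h2, h7, h8]
  clear h1 h2 h3 h4 h5 h6 h7 h8 h17
  linear_combination - 2 * g ξ k * (h11 - h13) + 2 * g ξ l * (h12 - 2 * h14 + h9)
    - 4 * g ξ k * g ξ l * h16

/-- The Ricci identities at (ξ, φj) and (ξ, j) suffice. The terms with ∇²φ in direction ξ cancel by
`D_φ_φ_scalar`, and those with ξ in the second slot are first-order by `D_ξ`. -/
theorem curvature_identity_ξ (h : IsContactTwoJet g φ ξ N t D F R) (j k l : E) :
    g (R ξ (φ j) (φ k)) (φ l) + g (R ξ j (φ k)) l - g (R ξ (φ j) k) l + g (R ξ j k) (φ l) =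
      2 * g (t (N j + (2 : ℝ) • φ j) k) l + 2 * g ξ k * g (N l) j - 2 * g ξ l * g (N k) j
        - 2 * g (t (φ j) k) l := by
  have h1 := h.ricci_φ_φ_scalar ξ (φ j) k l
  have h2 := h.ricci_φ_scalar ξ j k l
  have h3 := h.D_φ_φ_scalar ξ j k l
  simp only [h.D_ξ, h.F_ξ, h.t_ξ_left, h.Nξ, map_zero, zero_apply, map_neg, neg_apply] at h1 h2 h3
  have h4 := congrArg (fun v => g v k) (h.φF ξ j)
  have h5 := congrArg (fun v => g (t v k) (φ l)) (h.φN_add_Nφ j)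
  have h6 := h.t_φ_left_φ (N j) k l
  have h7 := congrArg (fun v => g v l) (h.t_φ_left j k)
  have h8 := h.skew (t j k) l
  have h9 := congrArg (fun v => g (N v) k) (h.φN_add_Nφ j)
  have h10 := h.dη k j
  have h11 := h.dη l j
  have h12 := h.Nφ_scalar (N j) k
  have h13 := h.symm k (φ j)
  have h14 := h.symm l (φ j)
  rw [h.ξN] at h6 h12
  simp only [map_add, map_smul, map_sub, add_apply, sub_apply, smul_apply,
    smul_eq_mul, h.t_ξ_left, h.Nξ, map_zero, zero_apply, mul_zero] at *
  linear_combination h1 + h2 + h3 + g ξ l * h4 + h5 - h6 + 2 * h8 - 2 * h7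
    + g ξ l * (h9 - h12 + 2 * h10 + 4 * h13) - 2 * g ξ k * (h11 + 2 * h14)

theorem curvature_identity_ξ_ξ (h : IsContactTwoJet g φ ξ N t D F R) (i k : E) :
    g (R (φ i) ξ (φ k)) ξ + g (R i ξ k) ξ =
      2 * (g (N i + (2 : ℝ) • φ i) (N k + (2 : ℝ) • φ k) - g (N i + (2 : ℝ) • φ i) (φ k)
        - g (φ i) (N k + (2 : ℝ) • φ k)) := by
  -- The remaining second-order part, F ξ, anticommutes with φ by `φF` and takes values orthogonal
  -- to ξ by `ξF`, so it drops out of the sum over (i,k) and (φi,φk).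
  have hR (i k) : g (R i ξ k) ξ = g (N (N i)) k + g (F ξ i) k := by
    have h1 := congrArg (fun v => g v k) (h.ricci_ξ i ξ)
    have h2 := h.R_skew i ξ k ξ
    rw [h.F_ξ] at h1
    simp only [map_sub, map_neg, sub_apply, neg_apply] at h1
    linear_combination h2 + h1
  rw [hR, hR]
  have h1 := congrArg (fun v => g v (φ k)) (h.φF ξ i)
  have h3 := h.ξF ξ i
  have h5 := h.dη (N i) k
  have h6 := h.dη (N (φ i)) (φ k)
  have h7 := h.Nφ_scalar i (N (φ k))
  have h8 := h.Nφ_scalar k (φ (N i))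
  have h9 := h.Nφ_scalar k i
  have h10 := h.Nφ_scalar i k
  have h11 := h.symm i (N (φ k))
  have h12 := h.symm (φ (N i)) (N (φ k))
  have h14 := h.skew (N k) i
  have h16 := h.symm (N (φ k)) (N (φ i))
  have h17 := h.symm (N k) (N i)
  have h18 := h.symm (φ i) (N k)
  have h19 := h.symm i k
  have h20 := h.symm k (φ (N i))
  have h21 := h.Nξ_right (φ i)
  rw [h.φφ] at h6
  simp only [map_add, map_smul, map_neg, add_apply, smul_apply, h.ξN, h.ξφ, h.φ_φ, h21,
    smul_eq_mul, h.t_ξ_left, h.Nξ, map_zero, zero_apply, mul_zero] at *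
  linear_combination h1 + h5 + h6 + h7 - h8 + 2 * h9 - 2 * h10 + 2 * h11 - h12
    - 4 * h19 + g ξ k * h3 - 2 * h14 - 2 * h18 + 2 * h17 + h16 - 2 * h20

end IsContactTwoJet

/-! ### Covariant differentiation on an open subset of a normed space

`Γ` is a torsion free connection, `∇_X Y = D_X Y + Γ(X, Y)`. -/

namespace LocalConnection

variable {E : Type*} [NormedAddCommGroup E] [NormedSpace ℝ E]

/-- The covariant derivative `X ↦ ∇_X ξ` of a vector field. -/
def covVec (Γ : E → E →L[ℝ] E →L[ℝ] E) (ξ : E → E) (y : E) : E →L[ℝ] E :=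
  fderiv ℝ ξ y + (Γ y).flip (ξ y)

/-- The covariant derivative `X ↦ ∇_X φ` of a field of endomorphisms. -/
def covEnd (Γ : E → E →L[ℝ] E →L[ℝ] E) (φ : E → E →L[ℝ] E) (y : E) : E →L[ℝ] E →L[ℝ] E :=
  fderiv ℝ φ y + ((ContinuousLinearMap.compL ℝ E E E).flip (φ y)).comp (Γ y)
    - (ContinuousLinearMap.compL ℝ E E E (φ y)).comp (Γ y)

/-- The covariant derivative `(∇_m t)(X, Y)` of a field of bilinear maps. -/
def covBilin (Γ : E → E →L[ℝ] E →L[ℝ] E) (t : E → E →L[ℝ] E →L[ℝ] E) (y m X Y : E) : E :=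
  fderiv ℝ t y m X Y + Γ y m (t y X Y) - t y (Γ y m X) Y - t y X (Γ y m Y)

/-- The curvature operator `R(X, Y)Z`. -/
def curv (Γ : E → E →L[ℝ] E →L[ℝ] E) (y X Y Z : E) : E :=
  fderiv ℝ Γ y X Y Z - fderiv ℝ Γ y Y X Z + Γ y X (Γ y Y Z) - Γ y Y (Γ y X Z)

/-- The vector field `Z` is differentiable at `y` and its covariant derivative in the direction
`m` is `z'`. -/
def HasCovAt (Γ : E → E →L[ℝ] E →L[ℝ] E) (y m : E) (Z : E → E) (z' : E) : Prop :=
  DifferentiableAt ℝ Z y ∧ fderiv ℝ Z y m + Γ y m (Z y) = z'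

/-- The function `f` is differentiable at `y` and its derivative in the direction `m` is `c`. -/
def HasDirAt (y m : E) (f : E → ℝ) (c : ℝ) : Prop :=
  DifferentiableAt ℝ f y ∧ fderiv ℝ f y m = c

variable {Γ : E → E →L[ℝ] E →L[ℝ] E} {y m : E} {Z W : E → E} {z' w' : E} {f f₁ : E → ℝ} {c c₁ : ℝ}

theorem covVec_apply (ξ : E → E) (X : E) :
    covVec Γ ξ y X = fderiv ℝ ξ y X + Γ y X (ξ y) := rfl

theorem covEnd_apply (φ : E → E →L[ℝ] E) (X Y : E) :
    covEnd Γ φ y X Y = fderiv ℝ φ y X Y + Γ y X (φ y Y) - φ y (Γ y X Y) := rfl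

/-- This is how identities between fields are differentiated: compute both sides by the product
rules and compare. -/
theorem HasCovAt.unique (hZ : HasCovAt Γ y m Z z') (hW : HasCovAt Γ y m W w')
    (h : Z =ᶠ[nhds y] W) : z' = w' := by
  rw [← hZ.2, ← hW.2, h.fderiv_eq, h.eq_of_nhds]

theorem HasDirAt.unique (hf : HasDirAt y m f c) (hf₁ : HasDirAt y m f₁ c₁)
    (h : f =ᶠ[nhds y] f₁) : c = c₁ := by
  rw [← hf.2, ← hf₁.2, h.fderiv_eq]

theorem HasDirAt.const (a : ℝ) : HasDirAt y m (fun _ => a) 0 :=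
  ⟨differentiableAt_const _, by simp⟩

theorem HasDirAt.add (hf : HasDirAt y m f c) (hf₁ : HasDirAt y m f₁ c₁) :
    HasDirAt y m (fun z => f z + f₁ z) (c + c₁) :=
  ⟨hf.1.add hf₁.1, by rw [fderiv_fun_add hf.1 hf₁.1, add_apply, hf.2, hf₁.2]⟩

theorem HasDirAt.sub (hf : HasDirAt y m f c) (hf₁ : HasDirAt y m f₁ c₁) :
    HasDirAt y m (fun z => f z - f₁ z) (c - c₁) :=
  ⟨hf.1.sub hf₁.1, by rw [fderiv_fun_sub hf.1 hf₁.1, sub_apply, hf.2, hf₁.2]⟩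

theorem HasDirAt.const_mul (a : ℝ) (hf : HasDirAt y m f c) :
    HasDirAt y m (fun z => a * f z) (a * c) :=
  ⟨hf.1.const_mul a, by rw [fderiv_const_mul hf.1, smul_apply, hf.2, smul_eq_mul]⟩

theorem HasCovAt.zero : HasCovAt Γ y m (fun _ => 0) 0 :=
  ⟨differentiableAt_const _, by simp⟩

theorem HasCovAt.add (hZ : HasCovAt Γ y m Z z') (hW : HasCovAt Γ y m W w') :
    HasCovAt Γ y m (fun z => Z z + W z) (z' + w') :=
  ⟨hZ.1.add hW.1, by
    rw [fderiv_fun_add hZ.1 hW.1, add_apply, map_add, ← hZ.2, ← hW.2]; abel⟩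

theorem HasCovAt.sub (hZ : HasCovAt Γ y m Z z') (hW : HasCovAt Γ y m W w') :
    HasCovAt Γ y m (fun z => Z z - W z) (z' - w') :=
  ⟨hZ.1.sub hW.1, by
    rw [fderiv_fun_sub hZ.1 hW.1, sub_apply, map_sub, ← hZ.2, ← hW.2]; abel⟩

theorem HasCovAt.neg (hZ : HasCovAt Γ y m Z z') : HasCovAt Γ y m (fun z => -Z z) (-z') :=
  ⟨hZ.1.neg, by rw [fderiv_fun_neg, neg_apply, map_neg, ← hZ.2]; abel⟩

theorem HasCovAt.smul (hf : HasDirAt y m f c) (hZ : HasCovAt Γ y m Z z') :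
    HasCovAt Γ y m (fun z => f z • Z z) (c • Z y + f y • z') :=
  ⟨hf.1.smul hZ.1, by
    rw [fderiv_fun_smul hf.1 hZ.1, ← hf.2, ← hZ.2]
    simp only [add_apply, smul_apply, ContinuousLinearMap.smulRight_apply, map_smul]
    module⟩

theorem hasCovAt_vec {ξ : E → E} (hξ : DifferentiableAt ℝ ξ y) :
    HasCovAt Γ y m ξ (covVec Γ ξ y m) := ⟨hξ, rfl⟩

theorem HasCovAt.endo {φ : E → E →L[ℝ] E} (hφ : DifferentiableAt ℝ φ y)
    (hZ : HasCovAt Γ y m Z z') :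
    HasCovAt Γ y m (fun z => φ z (Z z)) (covEnd Γ φ y m (Z y) + φ y z') := by
  refine ⟨hφ.clm_apply hZ.1, ?_⟩
  rw [fderiv_clm_apply hφ hZ.1, ← hZ.2]
  simp only [add_apply, ContinuousLinearMap.comp_apply, ContinuousLinearMap.flip_apply,
    map_add, covEnd_apply]
  abel

theorem HasCovAt.bilin {t : E → E →L[ℝ] E →L[ℝ] E} (ht : DifferentiableAt ℝ t y)
    (hZ : HasCovAt Γ y m Z z') (hW : HasCovAt Γ y m W w') :
    HasCovAt Γ y m (fun z => t z (Z z) (W z))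
      (covBilin Γ t y m (Z y) (W y) + t y z' (W y) + t y (Z y) w') := by
  refine ⟨(ht.clm_apply hZ.1).clm_apply hW.1, ?_⟩
  rw [fderiv_clm_apply (ht.clm_apply hZ.1) hW.1, fderiv_clm_apply ht hZ.1, ← hZ.2, ← hW.2]
  simp only [add_apply, ContinuousLinearMap.comp_apply, ContinuousLinearMap.flip_apply,
    map_add, covBilin]
  abel

theorem HasCovAt.inner {g : E → E →L[ℝ] E →L[ℝ] ℝ} (hg : DifferentiableAt ℝ g y)
    (hΓ : ∀ m X Y, fderiv ℝ g y m X Y = g y (Γ y m X) Y + g y X (Γ y m Y))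
    (hZ : HasCovAt Γ y m Z z') (hW : HasCovAt Γ y m W w') :
    HasDirAt y m (fun z => g z (Z z) (W z)) (g y z' (W y) + g y (Z y) w') := by
  refine ⟨(hg.clm_apply hZ.1).clm_apply hW.1, ?_⟩
  rw [fderiv_clm_apply (hg.clm_apply hZ.1) hW.1, fderiv_clm_apply hg hZ.1, ← hZ.2, ← hW.2]
  simp only [add_apply, ContinuousLinearMap.comp_apply, ContinuousLinearMap.flip_apply, map_add, hΓ]
  ring

/-- Every vector extends to a vector field that is parallel at a given point. -/
theorem exists_parallel (Γ : E → E →L[ℝ] E →L[ℝ] E) (y X : E) :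
    ∃ Z : E → E, Z y = X ∧ ∀ m, HasCovAt Γ y m Z 0 := by
  -- The affine field with derivative -Γ(·, X) at y cancels the connection term there.
  have h : HasFDerivAt (fun z => X - (Γ y).flip X (z - y)) (-(Γ y).flip X) y := by
    simpa using (((Γ y).flip X).hasFDerivAt.comp y ((hasFDerivAt_id y).sub_const y)).const_sub X
  exact ⟨fun z => X - (Γ y).flip X (z - y), by simp, fun m => ⟨h.differentiableAt, by
    rw [h.fderiv]; simp⟩⟩

set_option synthInstance.maxHeartbeats 200000 in
theorem contDiffAt_covVec {ξ : E → E} (hξ : ContDiffAt ℝ ∞ ξ y) (hΓ : ContDiffAt ℝ ∞ Γ y) :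
    ContDiffAt ℝ ∞ (covVec Γ ξ) y := by
  have h1 : ContDiffAt ℝ ∞ (fderiv ℝ ξ) y := hξ.fderiv_right (by simp)
  have h2 : ContDiffAt ℝ ∞ (fun z => (Γ z).flip) y :=
    (ContinuousLinearMap.flipₗᵢ ℝ E E E).toContinuousLinearEquiv.contDiff.contDiffAt.comp y hΓ
  exact h1.add (h2.clm_apply hξ)

set_option synthInstance.maxHeartbeats 200000 in
theorem contDiffAt_covEnd {φ : E → E →L[ℝ] E} (hφ : ContDiffAt ℝ ∞ φ y)
    (hΓ : ContDiffAt ℝ ∞ Γ y) : ContDiffAt ℝ ∞ (covEnd Γ φ) y := by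
  have h1 : ContDiffAt ℝ ∞ (fderiv ℝ φ) y := hφ.fderiv_right (by simp)
  have h2 : ContDiffAt ℝ ∞ (fun z => (ContinuousLinearMap.compL ℝ E E E).flip (φ z)) y :=
    (ContinuousLinearMap.contDiff _).contDiffAt.comp y hφ
  have h3 : ContDiffAt ℝ ∞ (fun z => (ContinuousLinearMap.compL ℝ E E E) (φ z)) y :=
    (ContinuousLinearMap.contDiff _).contDiffAt.comp y hφ
  exact (h1.add (h2.clm_comp hΓ)).sub (h3.clm_comp hΓ)

theorem fderiv_apply_apply {F G H : Type*} [NormedAddCommGroup F] [NormedSpace ℝ F]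
    [NormedAddCommGroup G] [NormedSpace ℝ G] [NormedAddCommGroup H] [NormedSpace ℝ H]
    {T : E → F →L[ℝ] G →L[ℝ] H} (hT : DifferentiableAt ℝ T y) (m : E) (X : F) (Y : G) :
    fderiv ℝ (fun z => T z X Y) y m = fderiv ℝ T y m X Y := by
  have h1 : DifferentiableAt ℝ (fun z => T z X) y := hT.clm_apply (differentiableAt_const _)
  rw [fderiv_clm_apply h1 (differentiableAt_const _),
    fderiv_clm_apply hT (differentiableAt_const _)]
  simp

theorem differentiableAt_fderiv {F : Type*} [NormedAddCommGroup F] [NormedSpace ℝ F]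
    {T : E → F} (hT : ContDiffAt ℝ ∞ T y) : DifferentiableAt ℝ (fderiv ℝ T) y :=
  (hT.fderiv_right (m := ∞) (by simp)).differentiableAt (by simp)

theorem fderiv_fderiv_symm {F : Type*} [NormedAddCommGroup F] [NormedSpace ℝ F]
    {T : E → F} (hT : ContDiffAt ℝ ∞ T y) (X Y : E) :
    fderiv ℝ (fderiv ℝ T) y X Y = fderiv ℝ (fderiv ℝ T) y Y X :=
  hT.isSymmSndFDerivAt (by simpa using WithTop.coe_le_coe.2 (le_top : (2 : ℕ∞) ≤ ⊤)) X Y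

theorem fderiv_apply {F G : Type*} [NormedAddCommGroup F] [NormedSpace ℝ F]
    [NormedAddCommGroup G] [NormedSpace ℝ G]
    {T : E → F →L[ℝ] G} (hT : DifferentiableAt ℝ T y) (m : E) (X : F) :
    fderiv ℝ (fun z => T z X) y m = fderiv ℝ T y m X := by
  rw [fderiv_clm_apply hT (differentiableAt_const _)]
  simp

set_option synthInstance.maxHeartbeats 200000 in
/-- The Ricci identity for a vector field. -/
theorem covEnd_covVec_sub {ξ : E → E} (hξ : ContDiffAt ℝ ∞ ξ y) (hΓ : ContDiffAt ℝ ∞ Γ y)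
    (hs : ∀ X Y, Γ y X Y = Γ y Y X) (X Y : E) :
    covEnd Γ (covVec Γ ξ) y X Y - covEnd Γ (covVec Γ ξ) y Y X = curv Γ y X Y (ξ y) := by
  have hξ' : DifferentiableAt ℝ (fderiv ℝ ξ) y :=
    differentiableAt_fderiv hξ
  have hξ1 := hξ.differentiableAt (by simp)
  have hΓ1 := hΓ.differentiableAt (by simp)
  have hsymm := fderiv_fderiv_symm hξ X Y
  have key (X Y : E) : fderiv ℝ (covVec Γ ξ) y X Y =
      fderiv ℝ (fderiv ℝ ξ) y X Y + fderiv ℝ Γ y X Y (ξ y) + Γ y Y (fderiv ℝ ξ y X) := by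
    have h0 := (contDiffAt_covVec hξ hΓ).differentiableAt (by simp)
    have h2 : DifferentiableAt ℝ (fun z => fderiv ℝ ξ z Y) y :=
      hξ'.clm_apply (differentiableAt_const _)
    have h3 : DifferentiableAt ℝ (fun z => Γ z Y) y := hΓ1.clm_apply (differentiableAt_const _)
    rw [← fderiv_apply h0]
    simp only [covVec_apply]
    rw [fderiv_fun_add h2 (h3.clm_apply hξ1), fderiv_clm_apply h3 hξ1]
    simp only [add_apply, ContinuousLinearMap.comp_apply, ContinuousLinearMap.flip_apply]
    rw [fderiv_apply hξ', fderiv_apply hΓ1]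
    abel
  rw [covEnd_apply, covEnd_apply, key, key, hsymm]
  simp only [covVec_apply, curv, map_add, hs Y X]
  abel

set_option synthInstance.maxHeartbeats 200000 in
/-- The Ricci identity for a field of endomorphisms. -/
theorem covBilin_covEnd_sub {φ : E → E →L[ℝ] E} (hφ : ContDiffAt ℝ ∞ φ y)
    (hΓ : ContDiffAt ℝ ∞ Γ y) (hs : ∀ X Y, Γ y X Y = Γ y Y X) (X Y Z : E) :
    covBilin Γ (covEnd Γ φ) y X Y Z - covBilin Γ (covEnd Γ φ) y Y X Z =
      curv Γ y X Y (φ y Z) - φ y (curv Γ y X Y Z) := by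
  have hφ' : DifferentiableAt ℝ (fderiv ℝ φ) y :=
    differentiableAt_fderiv hφ
  have hφ1 := hφ.differentiableAt (by simp)
  have hΓ1 := hΓ.differentiableAt (by simp)
  have hsymm := fderiv_fderiv_symm hφ X Y
  have key (X Y Z : E) : fderiv ℝ (covEnd Γ φ) y X Y Z =
      fderiv ℝ (fderiv ℝ φ) y X Y Z + fderiv ℝ Γ y X Y (φ y Z) + Γ y Y (fderiv ℝ φ y X Z)
        - fderiv ℝ φ y X (Γ y Y Z) - φ y (fderiv ℝ Γ y X Y Z) := by
    have h0 := (contDiffAt_covEnd hφ hΓ).differentiableAt (by simp)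
    rw [← fderiv_apply_apply h0]
    have h2 : DifferentiableAt ℝ (fun z => fderiv ℝ φ z Y Z) y :=
      (hφ'.clm_apply (differentiableAt_const _)).clm_apply (differentiableAt_const _)
    have h3 : DifferentiableAt ℝ (fun z => Γ z Y) y := hΓ1.clm_apply (differentiableAt_const _)
    have h4 : DifferentiableAt ℝ (fun z => φ z Z) y := hφ1.clm_apply (differentiableAt_const _)
    have h5 : DifferentiableAt ℝ (fun z => Γ z Y Z) y := h3.clm_apply (differentiableAt_const _)
    simp only [covEnd_apply]
    rw [fderiv_fun_sub (h2.fun_add (h3.clm_apply h4)) (hφ1.clm_apply h5),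
      fderiv_fun_add h2 (h3.clm_apply h4), fderiv_clm_apply h3 h4, fderiv_clm_apply hφ1 h5]
    simp only [add_apply, sub_apply, ContinuousLinearMap.comp_apply, ContinuousLinearMap.flip_apply]
    rw [fderiv_apply_apply hφ', fderiv_apply_apply hΓ1, fderiv_apply hφ1, fderiv_apply hΓ1]
    abel
  rw [covBilin, covBilin, key, key, hsymm]
  simp only [covEnd_apply, curv, map_add, map_sub, hs Y X]
  abel

/-- Vanishing torsion near y, not just at y, makes the derivative of Γ symmetric in its last two
arguments as well. -/
theorem curv_bianchi (hΓ : ContDiffAt ℝ ∞ Γ y) (hs : ∀ᶠ z in nhds y, ∀ X Y, Γ z X Y = Γ z Y X)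
    (X Y Z : E) : curv Γ y X Y Z + curv Γ y Y Z X + curv Γ y Z X Y = 0 := by
  have hΓ1 := hΓ.differentiableAt (by simp)
  have hs' (m X Y : E) : fderiv ℝ Γ y m X Y = fderiv ℝ Γ y m Y X := by
    rw [← fderiv_apply_apply hΓ1, ← fderiv_apply_apply hΓ1]
    congr 1
    exact Filter.EventuallyEq.fderiv_eq (hs.mono fun z hz => hz X Y)
  have hs0 := hs.self_of_nhds
  simp only [curv]
  rw [hs' X Z Y, hs' Y X Z, hs' Z Y X, hs0 X Z, hs0 Y X, hs0 Z Y]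
  abel

-- For constant fields Z, W, metric compatibility computes the second derivative of g(Z, W); its
-- symmetry is the skewness of the curvature.
set_option synthInstance.maxHeartbeats 200000 in
theorem curv_skew {g : E → E →L[ℝ] E →L[ℝ] ℝ} (hg : ContDiffAt ℝ ∞ g y)
    (hΓ : ContDiffAt ℝ ∞ Γ y) (hgs : ∀ X Y, g y X Y = g y Y X)
    (hm : ∀ᶠ z in nhds y, ∀ m X Y, fderiv ℝ g z m X Y = g z (Γ z m X) Y + g z X (Γ z m Y))
    (X Y Z W : E) : g y (curv Γ y X Y Z) W = -g y (curv Γ y X Y W) Z := by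
  have hg1 := hg.differentiableAt (by simp)
  have hΓ1 := hΓ.differentiableAt (by simp)
  have hm0 := hm.self_of_nhds
  have hg2 : ∀ᶠ z in nhds y, DifferentiableAt ℝ g z :=
    ((hg.of_le (m := 1) (by simp)).eventually (by simp)).mono
      fun z hz => hz.differentiableAt (by simp)
  have hf : ContDiffAt ℝ ∞ (fun z => g z Z W) y :=
    (hg.clm_apply contDiffAt_const).clm_apply contDiffAt_const
  have key (X Y : E) : fderiv ℝ (fderiv ℝ fun z => g z Z W) y X Y =
      g y (Γ y X (Γ y Y Z)) W + g y (Γ y Y Z) (Γ y X W) + g y (fderiv ℝ Γ y X Y Z) W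
      + (g y (Γ y X Z) (Γ y Y W) + g y Z (Γ y X (Γ y Y W)) + g y Z (fderiv ℝ Γ y X Y W)) := by
    have h2 (V : E) : DifferentiableAt ℝ (fun z => Γ z Y V) y :=
      (hΓ1.clm_apply (differentiableAt_const _)).clm_apply (differentiableAt_const _)
    have h4 : (fun z => fderiv ℝ (fun z => g z Z W) z Y) =ᶠ[nhds y]
      fun z => g z (Γ z Y Z) W + g z Z (Γ z Y W) := by
      filter_upwards [hm, hg2] with z hz hz'
      rw [fderiv_apply_apply hz', hz]
    have h5 : DifferentiableAt ℝ (fun z => g z (Γ z Y Z)) y := hg1.clm_apply (h2 Z)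
    have h6 : DifferentiableAt ℝ (fun z => g z Z) y := hg1.clm_apply (differentiableAt_const _)
    have h7 : DifferentiableAt ℝ (fun z => g z (Γ z Y Z) W) y :=
      h5.clm_apply (differentiableAt_const _)
    rw [← fderiv_apply (differentiableAt_fderiv hf), h4.fderiv_eq,
      fderiv_fun_add h7 (h6.clm_apply (h2 W)), add_apply, fderiv_apply h5,
      fderiv_clm_apply h6 (h2 W), fderiv_clm_apply hg1 (h2 Z)]
    simp only [add_apply, ContinuousLinearMap.comp_apply, ContinuousLinearMap.flip_apply]
    rw [fderiv_apply hg1, fderiv_apply_apply hΓ1, fderiv_apply_apply hΓ1, hm0, hm0]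
    ring
  have h1 := key X Y
  have h2 := key Y X
  rw [← fderiv_fderiv_symm hf, h1] at h2
  rw [hgs (curv Γ y X Y W)]
  simp only [curv, map_add, map_sub, add_apply, sub_apply]
  linear_combination h2

end LocalConnection

/-! ### Contact metric structures on an open subset of a normed space. -/

open LocalConnection

/-- A contact metric structure `(φ, ξ, g)` on an open subset `U` of a normed space, with the
Levi-Civita connection `Γ` of `g`. -/
structure IsLocalContactMetric {E : Type*} [NormedAddCommGroup E] [NormedSpace ℝ E] (U : Set E)
    (g : E → E →L[ℝ] E →L[ℝ] ℝ) (Γ : E → E →L[ℝ] E →L[ℝ] E) (φ : E → E →L[ℝ] E) (ξ : E → E) :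
    Prop where
  isOpen : IsOpen U
  contDiff_g : ContDiffOn ℝ ∞ g U
  contDiff_Γ : ContDiffOn ℝ ∞ Γ U
  contDiff_φ : ContDiffOn ℝ ∞ φ U
  contDiff_ξ : ContDiffOn ℝ ∞ ξ U
  symm : ∀ y ∈ U, ∀ X Y, g y X Y = g y Y X
  nondeg : ∀ y ∈ U, ∀ X, (∀ Z, g y X Z = 0) → X = 0
  Γ_symm : ∀ y ∈ U, ∀ X Y, Γ y X Y = Γ y Y X
  Γ_metric : ∀ y ∈ U, ∀ m X Y,
    fderiv ℝ g y m X Y = g y (Γ y m X) Y + g y X (Γ y m Y)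
  φφ : ∀ y ∈ U, ∀ X, φ y (φ y X) = -X + g y (ξ y) X • ξ y
  φξ : ∀ y ∈ U, φ y (ξ y) = 0
  ξξ : ∀ y ∈ U, g y (ξ y) (ξ y) = 1
  skew : ∀ y ∈ U, ∀ X Y, g y (φ y X) Y = -g y X (φ y Y)
  dη : ∀ y ∈ U, ∀ X Y, fderiv ℝ (fun z => g z (ξ z) Y) y X -
    fderiv ℝ (fun z => g z (ξ z) X) y Y = 2 * g y X (φ y Y)

namespace IsLocalContactMetric

variable {E : Type*} [NormedAddCommGroup E] [NormedSpace ℝ E] {U : Set E}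
  {g : E → E →L[ℝ] E →L[ℝ] ℝ} {Γ : E → E →L[ℝ] E →L[ℝ] E} {φ : E → E →L[ℝ] E} {ξ : E → E}
  {y : E}

theorem eventually (h : IsLocalContactMetric U g Γ φ ξ) (hy : y ∈ U) : ∀ᶠ z in nhds y, z ∈ U :=
  h.isOpen.mem_nhds hy

theorem eventuallyEq {F : Type*} {Z W : E → F} (h : IsLocalContactMetric U g Γ φ ξ) (hy : y ∈ U)
    (H : ∀ z ∈ U, Z z = W z) : Z =ᶠ[nhds y] W :=
  (h.eventually hy).mono H

theorem contDiffAt_g (h : IsLocalContactMetric U g Γ φ ξ) (hy : y ∈ U) : ContDiffAt ℝ ∞ g y :=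
  h.contDiff_g.contDiffAt (h.isOpen.mem_nhds hy)

theorem contDiffAt_Γ (h : IsLocalContactMetric U g Γ φ ξ) (hy : y ∈ U) : ContDiffAt ℝ ∞ Γ y :=
  h.contDiff_Γ.contDiffAt (h.isOpen.mem_nhds hy)

theorem contDiffAt_φ (h : IsLocalContactMetric U g Γ φ ξ) (hy : y ∈ U) : ContDiffAt ℝ ∞ φ y :=
  h.contDiff_φ.contDiffAt (h.isOpen.mem_nhds hy)

theorem contDiffAt_ξ (h : IsLocalContactMetric U g Γ φ ξ) (hy : y ∈ U) : ContDiffAt ℝ ∞ ξ y :=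
  h.contDiff_ξ.contDiffAt (h.isOpen.mem_nhds hy)

theorem diff_φ (h : IsLocalContactMetric U g Γ φ ξ) (hy : y ∈ U) : DifferentiableAt ℝ φ y :=
  (h.contDiffAt_φ hy).differentiableAt (by simp)

theorem diff_N (h : IsLocalContactMetric U g Γ φ ξ) (hy : y ∈ U) :
    DifferentiableAt ℝ (covVec Γ ξ) y :=
  (contDiffAt_covVec (h.contDiffAt_ξ hy) (h.contDiffAt_Γ hy)).differentiableAt (by simp)

theorem diff_t (h : IsLocalContactMetric U g Γ φ ξ) (hy : y ∈ U) :
    DifferentiableAt ℝ (covEnd Γ φ) y :=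
  (contDiffAt_covEnd (h.contDiffAt_φ hy) (h.contDiffAt_Γ hy)).differentiableAt (by simp)

theorem hasCov_ξ (h : IsLocalContactMetric U g Γ φ ξ) (hy : y ∈ U) (m : E) :
    HasCovAt Γ y m ξ (covVec Γ ξ y m) :=
  hasCovAt_vec ((h.contDiffAt_ξ hy).differentiableAt (by simp))

theorem hasDir_g (h : IsLocalContactMetric U g Γ φ ξ) (hy : y ∈ U) {m : E} {Z W : E → E}
    {z' w' : E} (hZ : HasCovAt Γ y m Z z') (hW : HasCovAt Γ y m W w') :
    HasDirAt y m (fun z => g z (Z z) (W z)) (g y z' (W y) + g y (Z y) w') :=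
  HasCovAt.inner ((h.contDiffAt_g hy).differentiableAt (by simp)) (h.Γ_metric y hy) hZ hW

theorem ricci_ξ (h : IsLocalContactMetric U g Γ φ ξ) (hy : y ∈ U) (X Y : E) :
    covEnd Γ (covVec Γ ξ) y X Y - covEnd Γ (covVec Γ ξ) y Y X = curv Γ y X Y (ξ y) :=
  covEnd_covVec_sub (h.contDiffAt_ξ hy) (h.contDiffAt_Γ hy) (h.Γ_symm y hy) X Y

theorem curv_skew (h : IsLocalContactMetric U g Γ φ ξ) (hy : y ∈ U) (X Y Z W : E) :
    g y (curv Γ y X Y Z) W = -g y (curv Γ y X Y W) Z :=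
  LocalConnection.curv_skew (h.contDiffAt_g hy) (h.contDiffAt_Γ hy) (h.symm y hy)
    ((h.eventually hy).mono h.Γ_metric) X Y Z W

theorem dη_cov (h : IsLocalContactMetric U g Γ φ ξ) (hy : y ∈ U) (X Y : E) :
    g y (covVec Γ ξ y X) Y - g y (covVec Γ ξ y Y) X = 2 * g y X (φ y Y) := by
  have hg := (h.contDiffAt_g hy).differentiableAt (by simp)
  have hξ := (h.contDiffAt_ξ hy).differentiableAt (by simp)
  have key (X Y : E) : fderiv ℝ (fun z => g z (ξ z) Y) y X =
      g y (covVec Γ ξ y X) Y + g y (ξ y) (Γ y X Y) := by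
    rw [fderiv_apply (hg.clm_apply hξ), fderiv_clm_apply hg hξ]
    simp only [add_apply, ContinuousLinearMap.comp_apply, ContinuousLinearMap.flip_apply,
      covVec_apply, map_add, h.Γ_metric y hy]
    ring
  have := h.dη y hy X Y
  rw [key, key, h.Γ_symm y hy Y X] at this
  linear_combination this

/-- Closedness of dη in covariant form. Differentiating `dη_cov` writes ∇φ through ∇²ξ; in the
cyclic sum the Ricci identity leaves g(ξ, ·) of the Bianchi sum, which is zero. -/
theorem t_cyc (h : IsLocalContactMetric U g Γ φ ξ) (hy : y ∈ U) (X Y Z : E) :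
    g y (covEnd Γ φ y X Y) Z + g y (covEnd Γ φ y Y Z) X + g y (covEnd Γ φ y Z X) Y = 0 := by
  have key (m X Y : E) : g y (covEnd Γ (covVec Γ ξ) y m X) Y - g y (covEnd Γ (covVec Γ ξ) y m Y) X
      = 2 * g y (covEnd Γ φ y m Y) X := by
    obtain ⟨X', rfl, hX⟩ := exists_parallel Γ y X
    obtain ⟨Y', rfl, hY⟩ := exists_parallel Γ y Y
    have h1 := (h.hasDir_g hy ((hX m).endo (h.diff_N hy)) (hY m)).sub
      (h.hasDir_g hy ((hY m).endo (h.diff_N hy)) (hX m))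
    have h2 := (h.hasDir_g hy (hX m) ((hY m).endo (h.diff_φ hy))).const_mul 2
    have h3 := h1.unique h2 (h.eventuallyEq hy fun z hz => h.dη_cov hz _ _)
    simp only [map_zero, add_zero, zero_apply, zero_add] at h3
    rw [h3, h.symm y hy]
  have hb := congrArg (g y (ξ y))
    (curv_bianchi (h.contDiffAt_Γ hy) ((h.eventually hy).mono h.Γ_symm) X Y Z)
  have hr (X Y Z : E) : g y (covEnd Γ (covVec Γ ξ) y X Y) Z - g y (covEnd Γ (covVec Γ ξ) y Y X) Z
      = -g y (ξ y) (curv Γ y X Y Z) := by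
    have h1 := congrArg (fun v => g y v Z) (h.ricci_ξ hy X Y)
    rw [h.symm y hy (ξ y), ← h.curv_skew hy]
    simpa using h1
  have h1 := key X Z Y
  have h2 := key Y X Z
  have h3 := key Z Y X
  have h4 := hr X Y Z
  have h5 := hr Y Z X
  have h6 := hr Z X Y
  simp only [map_add, map_zero] at hb
  linear_combination (-h1 - h2 - h3 - h4 - h5 - h6 + hb) / 2

theorem isContactJet (h : IsLocalContactMetric U g Γ φ ξ) (hy : y ∈ U) :
    IsContactJet (g y) (φ y) (ξ y) (covVec Γ ξ y) (covEnd Γ φ y) where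
  symm := h.symm y hy
  nondeg := h.nondeg y hy
  φφ := h.φφ y hy
  φξ := h.φξ y hy
  ξξ := h.ξξ y hy
  skew := h.skew y hy
  dη := h.dη_cov hy
  ξN m := by
    have h1 := (h.hasDir_g hy (h.hasCov_ξ hy m) (h.hasCov_ξ hy m)).unique (.const 1)
      (h.eventuallyEq hy h.ξξ)
    rw [h.symm y hy (covVec Γ ξ y m)] at h1
    linarith
  t_skew m X Y := by
    obtain ⟨X', rfl, hX⟩ := exists_parallel Γ y X
    obtain ⟨Y', rfl, hY⟩ := exists_parallel Γ y Y
    have h1 := ((h.hasDir_g hy ((hX m).endo (h.diff_φ hy)) (hY m)).add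
      (h.hasDir_g hy (hX m) ((hY m).endo (h.diff_φ hy)))).unique (.const 0)
      (h.eventuallyEq hy fun z hz => by rw [h.skew z hz]; ring)
    simp only [map_zero, add_zero, zero_apply, zero_add] at h1
    linarith
  t_cyc := h.t_cyc hy
  t_φ m X := by
    obtain ⟨X', rfl, hX⟩ := exists_parallel Γ y X
    have h1 := (((hX m).endo (h.diff_φ hy)).endo (h.diff_φ hy)).unique
      ((hX m).neg.add (.smul (h.hasDir_g hy (h.hasCov_ξ hy m) (hX m)) (h.hasCov_ξ hy m)))
      (h.eventuallyEq hy fun z hz => h.φφ z hz _)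
    simpa using h1
  t_ξ m := by
    have h1 := ((h.hasCov_ξ hy m).endo (h.diff_φ hy)).unique .zero (h.eventuallyEq hy h.φξ)
    exact eq_neg_of_add_eq_zero_left h1

/-- The first-order consequences hold at all points of U, so `t_φ_left`, `ξt`, `φN_add_Nφ`,
`t_ξ_left`, `Nξ` and `ξN` can each be differentiated along fields parallel at y. -/
theorem isContactTwoJet (h : IsLocalContactMetric U g Γ φ ξ) (hy : y ∈ U) :
    IsContactTwoJet (g y) (φ y) (ξ y) (covVec Γ ξ y) (covEnd Γ φ y)
      (covBilin Γ (covEnd Γ φ) y) (fun X Y => covEnd Γ (covVec Γ ξ) y X Y) (curv Γ y) where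
  toIsContactJet := h.isContactJet hy
  D_φ m X Y := by
    obtain ⟨X', rfl, hX⟩ := exists_parallel Γ y X
    obtain ⟨Y', rfl, hY⟩ := exists_parallel Γ y Y
    have hφX := (hX m).endo (h.diff_φ hy)
    have h1 := ((hφX.bilin (h.diff_t hy) (hY m)).add
      (((hX m).bilin (h.diff_t hy) (hY m)).endo (h.diff_φ hy))).unique
      (.sub (.smul ((h.hasDir_g hy ((hX m).endo (h.diff_N hy)) (hY m)).add
        ((h.hasDir_g hy hφX (hY m)).const_mul 2)) (h.hasCov_ξ hy m))
        (.smul ((h.hasDir_g hy (h.hasCov_ξ hy m) (hY m)).const_mul 2) hφX))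
      (h.eventuallyEq hy fun z hz => (h.isContactJet hz).t_φ_left _ _)
    simpa using h1
  ξD m X Y := by
    obtain ⟨X', rfl, hX⟩ := exists_parallel Γ y X
    obtain ⟨Y', rfl, hY⟩ := exists_parallel Γ y Y
    have h1 := (h.hasDir_g hy (h.hasCov_ξ hy m) ((hX m).bilin (h.diff_t hy) (hY m))).unique
      (h.hasDir_g hy (((hX m).endo (h.diff_N hy)).endo (h.diff_φ hy)) (hY m))
      (h.eventuallyEq hy fun z hz => (h.isContactJet hz).ξt _ _)
    simpa using h1
  φF m X := by
    obtain ⟨X', rfl, hX⟩ := exists_parallel Γ y X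
    have h1 := (HasCovAt.add (((hX m).endo (h.diff_N hy)).endo (h.diff_φ hy))
      (((hX m).endo (h.diff_φ hy)).endo (h.diff_N hy))).unique
      (.smul (.const 2) ((hX m).sub (.smul (h.hasDir_g hy (h.hasCov_ξ hy m) (hX m))
        (h.hasCov_ξ hy m))))
      (h.eventuallyEq hy fun z hz => (h.isContactJet hz).φN_add_Nφ _)
    simp only [map_zero, add_zero, zero_smul, zero_add, zero_sub] at h1
    rw [h1]
    module
  D_ξ m Y := by
    obtain ⟨Y', rfl, hY⟩ := exists_parallel Γ y Y
    have h1 := ((h.hasCov_ξ hy m).bilin (h.diff_t hy) (hY m)).unique .zero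
      (h.eventuallyEq hy fun z hz => (h.isContactJet hz).t_ξ_left _)
    rw [map_zero, add_zero] at h1
    exact eq_neg_of_add_eq_zero_left h1
  F_ξ m := eq_neg_of_add_eq_zero_left (((h.hasCov_ξ hy m).endo (h.diff_N hy)).unique .zero
    (h.eventuallyEq hy fun z hz => (h.isContactJet hz).Nξ))
  ξF m X := by
    obtain ⟨X', rfl, hX⟩ := exists_parallel Γ y X
    have h1 := (h.hasDir_g hy (h.hasCov_ξ hy m) ((hX m).endo (h.diff_N hy))).unique (.const 0)
      (h.eventuallyEq hy fun z hz => (h.isContactJet hz).ξN _)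
    rw [map_zero, add_zero] at h1
    exact eq_neg_of_add_eq_zero_right h1
  ricci_φ X Y Z :=
    covBilin_covEnd_sub (h.contDiffAt_φ hy) (h.contDiffAt_Γ hy) (h.Γ_symm y hy) X Y Z
  ricci_ξ := h.ricci_ξ hy
  R_skew := h.curv_skew hy

end IsLocalContactMetric

/-! ### From index families on ℝ^m to tensor fields. -/

namespace Coord

variable {m : ℕ} {F : Type*} [NormedAddCommGroup F] [NormedSpace ℝ F]

/-- The `i`-th vector of the standard basis. -/
abbrev basisVec (i : Fin m) : Coord m := EuclideanSpace.single i 1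

/-- The linear map with prescribed values on the standard basis. -/
def lin (v : Fin m → F) : Coord m →L[ℝ] F :=
  ∑ i, (EuclideanSpace.proj i : Coord m →L[ℝ] ℝ).smulRight (v i)

theorem lin_apply (v : Fin m → F) (X : Coord m) : lin v X = ∑ i, X i • v i := by
  simp [lin, sum_apply]

@[simp] theorem lin_basisVec (v : Fin m → F) (i : Fin m) : lin v (basisVec i) = v i := by
  simp [lin_apply]

theorem sum_basisVec (X : Coord m) : ∑ i, X i • basisVec i = X := by
  ext j
  simp [Pi.single_apply]

theorem map_eq_sum {f : Coord m → F} (hf : IsLinearMap ℝ f) (X : Coord m) :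
    f X = ∑ i, X i • f (basisVec i) := by
  conv_lhs => rw [← sum_basisVec X]
  rw [← hf.mk'_apply, map_sum]
  simp

theorem eq_of_basisVec {f f' : Coord m → F} (hf : IsLinearMap ℝ f) (hf' : IsLinearMap ℝ f')
    (h : ∀ i, f (basisVec i) = f' (basisVec i)) (X : Coord m) : f X = f' X := by
  rw [map_eq_sum hf, map_eq_sum hf']
  simp [h]

theorem contDiffOn_lin {U : Set (Coord m)} {v : Coord m → Fin m → F}
    (h : ∀ i, ContDiffOn ℝ ∞ (fun y => v y i) U) : ContDiffOn ℝ ∞ (fun y => lin (v y)) U :=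
  ContDiffOn.sum fun i _ =>
    ((ContinuousLinearMap.smulRightL ℝ (Coord m) F
      (EuclideanSpace.proj i)).contDiff).comp_contDiffOn
      (h i)

theorem contDiffOn_toLp {U : Set (Coord m)} {v : Coord m → Fin m → ℝ}
    (h : ∀ i, ContDiffOn ℝ ∞ (fun y => v y i) U) :
    ContDiffOn ℝ ∞ (fun y => (WithLp.toLp 2 (v y) : Coord m)) U :=
  contDiffOn_euclidean.2 h

/-- The field of bilinear forms with the components `g i j`. -/
def bilinField (g : Fin m → Fin m → Coord m → ℝ) (y : Coord m) : Coord m →L[ℝ] Coord m →L[ℝ] ℝ :=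
  lin fun i => lin fun j => g i j y

/-- The field of endomorphisms with the components `φ i a`, that is `∂ᵢ ↦ ∑ₐ φᵢᵃ ∂ₐ`. -/
def endField (φ : Fin m → Fin m → Coord m → ℝ) (y : Coord m) : Coord m →L[ℝ] Coord m :=
  lin fun i => WithLp.toLp 2 fun a => φ i a y

/-- The vector field with the components `ξ a`. -/
def vecField (ξ : Fin m → Coord m → ℝ) (y : Coord m) : Coord m := WithLp.toLp 2 fun a => ξ a y

/-- The Levi-Civita connection of the metric with the components `g i j`. -/
def connField (g : Fin m → Fin m → Coord m → ℝ) (y : Coord m) :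
    Coord m →L[ℝ] Coord m →L[ℝ] Coord m :=
  lin fun i => lin fun j => WithLp.toLp 2 fun k => christoffel g k i j y

@[simp] theorem bilinField_basisVec (g : Fin m → Fin m → Coord m → ℝ) (y : Coord m)
    (i j : Fin m) : bilinField g y (basisVec i) (basisVec j) = g i j y := by
  simp only [bilinField, lin_basisVec]

@[simp] theorem endField_basisVec (φ : Fin m → Fin m → Coord m → ℝ) (y : Coord m)
    (i a : Fin m) : endField φ y (basisVec i) a = φ i a y := by
  simp only [endField, lin_basisVec]

@[simp] theorem connField_basisVec (g : Fin m → Fin m → Coord m → ℝ) (y : Coord m)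
    (i j k : Fin m) : connField g y (basisVec i) (basisVec j) k = christoffel g k i j y := by
  simp only [connField, lin_basisVec]

theorem contDiffOn_partialDeriv {U : Set (Coord m)} (hU : IsOpen U) {f : Coord m → ℝ}
    (hf : ContDiffOn ℝ ∞ f U) (i : Fin m) : ContDiffOn ℝ ∞ (partialDeriv i f) U :=
  (hf.fderiv_of_isOpen hU (by simp)).clm_apply contDiffOn_const

theorem contDiffOn_det {U : Set (Coord m)} {A : Coord m → Matrix (Fin m) (Fin m) ℝ}
    (h : ∀ i j, ContDiffOn ℝ ∞ (fun y => A y i j) U) : ContDiffOn ℝ ∞ (fun y => (A y).det) U := by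
  simp only [Matrix.det_apply']
  exact ContDiffOn.sum fun σ _ => contDiffOn_const.mul (contDiffOn_prod fun i _ => h _ _)

theorem contDiffOn_metricInv {U : Set (Coord m)} {g : Fin m → Fin m → Coord m → ℝ}
    (h : ∀ i j, ContDiffOn ℝ ∞ (g i j) U)
    (hdet : ∀ y ∈ U, (Matrix.of fun a b => g a b y).det ≠ 0) (i j : Fin m) :
    ContDiffOn ℝ ∞ (metricInv g i j) U := by
  have h1 : metricInv g i j = fun y => (Matrix.of fun a b => g a b y).det⁻¹ *
      (Matrix.of fun a b => g a b y).adjugate i j := by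
    ext y
    simp [metricInv, Matrix.inv_def]
  rw [h1]
  refine ((contDiffOn_det fun i j => h i j).inv hdet).mul ?_
  simp only [Matrix.adjugate_apply]
  refine contDiffOn_det fun a b => ?_
  -- The adjugate entry is the determinant after row j is replaced by a basis vector, so that row is
  -- constant.
  by_cases hab : a = j
  · subst hab
    simpa using contDiffOn_const
  · simpa [hab] using h a b

theorem contDiffOn_christoffel {U : Set (Coord m)} (hU : IsOpen U)
    {g : Fin m → Fin m → Coord m → ℝ} (h : ∀ i j, ContDiffOn ℝ ∞ (g i j) U)
    (hdet : ∀ y ∈ U, (Matrix.of fun a b => g a b y).det ≠ 0) (k i j : Fin m) :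
    ContDiffOn ℝ ∞ (christoffel g k i j) U :=
  contDiffOn_const.mul <| ContDiffOn.sum fun l _ => (contDiffOn_metricInv h hdet k l).mul
    (((contDiffOn_partialDeriv hU (h _ _) _).add (contDiffOn_partialDeriv hU (h _ _) _)).sub
      (contDiffOn_partialDeriv hU (h _ _) _))

section Pointwise

variable {g : Fin m → Fin m → Coord m → ℝ} {y : Coord m}

theorem bilinField_apply_basisVec (X : Coord m) (j : Fin m) :
    bilinField g y X (basisVec j) = ∑ i, X i * g i j y := by
  rw [map_eq_sum (f := fun X => bilinField g y X (basisVec j)) ⟨by simp, by simp⟩]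
  simp only [bilinField_basisVec, smul_eq_mul]

theorem bilinField_symm (hs : ∀ i j, g i j y = g j i y) (X Y : Coord m) :
    bilinField g y X Y = bilinField g y Y X := by
  refine eq_of_basisVec (f := fun X => bilinField g y X Y) (f' := fun X => bilinField g y Y X)
    ⟨by simp, by simp⟩ ⟨by simp, by simp⟩ (fun i => ?_) X
  refine eq_of_basisVec (f := fun Y => bilinField g y (basisVec i) Y)
    (f' := fun Y => bilinField g y Y (basisVec i)) ⟨by simp, by simp⟩ ⟨by simp, by simp⟩
    (fun j => ?_) Y
  simp only [bilinField_basisVec, hs i j]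

theorem det_ne_zero (hn : ∀ X, (∀ Z, bilinField g y X Z = 0) → X = 0) :
    (Matrix.of fun a b => g a b y).det ≠ 0 := by
  intro h
  obtain ⟨v, hv, hv'⟩ := Matrix.exists_vecMul_eq_zero_iff.2 h
  refine hv ?_
  have h1 := hn (WithLp.toLp 2 v) fun Z => by
    refine eq_of_basisVec (f := fun Z => bilinField g y (WithLp.toLp 2 v) Z) (f' := fun _ => 0)
      ⟨by simp, by simp⟩ ⟨by simp, by simp⟩ (fun j => ?_) Z
    rw [bilinField_apply_basisVec]
    exact congrFun hv' j
  simpa using h1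

variable (hs : ∀ i j, g i j y = g j i y) (hdet : (Matrix.of fun a b => g a b y).det ≠ 0)
include hdet

theorem sum_metricInv_mul (i j : Fin m) :
    ∑ k, metricInv g i k y * g k j y = if i = j then 1 else 0 := by
  have := congrFun (congrFun (Matrix.nonsing_inv_mul _ (isUnit_iff_ne_zero.2 hdet)) i) j
  rw [Matrix.one_apply, Matrix.mul_apply] at this
  exact this

theorem sum_mul_metricInv (i j : Fin m) :
    ∑ k, g i k y * metricInv g k j y = if i = j then 1 else 0 := by
  have := congrFun (congrFun (Matrix.mul_nonsing_inv _ (isUnit_iff_ne_zero.2 hdet)) i) j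
  rw [Matrix.one_apply, Matrix.mul_apply] at this
  exact this

include hs

/-- Raising an index. -/
theorem sum_metricInv_bilinField (X : Coord m) (a : Fin m) :
    ∑ b, metricInv g a b y * bilinField g y X (basisVec b) = X a := by
  simp only [bilinField_apply_basisVec, Finset.mul_sum]
  rw [Finset.sum_comm]
  calc ∑ i, ∑ b, metricInv g a b y * (X i * g i b y)
      = ∑ i, X i * ∑ b, metricInv g a b y * g b i y := by
        simp only [Finset.mul_sum, hs]
        refine Finset.sum_congr rfl fun i _ => Finset.sum_congr rfl fun b _ => ?_
        ring
    _ = X a := by simp [sum_metricInv_mul hdet]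

/-- Lowering the upper index of the Christoffel symbols. -/
theorem bilinField_connField (i j l : Fin m) :
    bilinField g y (connField g y (basisVec i) (basisVec j)) (basisVec l) =
      (1 / 2 : ℝ) * (partialDeriv i (g j l) y + partialDeriv j (g i l) y
        - partialDeriv l (g i j) y) := by
  rw [bilinField_apply_basisVec]
  simp only [connField_basisVec, christoffel]
  calc _ = (1 / 2 : ℝ) * ∑ r, (∑ k, g l k y * metricInv g k r y) *
        (partialDeriv i (g j r) y + partialDeriv j (g i r) y - partialDeriv r (g i j) y) := by
        simp only [Finset.mul_sum, Finset.sum_mul]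
        rw [Finset.sum_comm]
        refine Finset.sum_congr rfl fun r _ => Finset.sum_congr rfl fun k _ => ?_
        rw [hs l k]
        ring
    _ = _ := by simp [sum_mul_metricInv hdet]

end Pointwise

variable {U : Set (Coord m)} {g : Fin m → Fin m → Coord m → ℝ} {y : Coord m}

theorem contDiffOn_bilinField (h : ∀ i j, ContDiffOn ℝ ∞ (g i j) U) :
    ContDiffOn ℝ ∞ (bilinField g) U :=
  contDiffOn_lin fun i => contDiffOn_lin fun j => h i j

theorem contDiffOn_endField {φ : Fin m → Fin m → Coord m → ℝ}
    (h : ∀ i a, ContDiffOn ℝ ∞ (φ i a) U) : ContDiffOn ℝ ∞ (endField φ) U :=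
  contDiffOn_lin fun i => contDiffOn_toLp fun a => h i a

theorem contDiffOn_vecField {ξ : Fin m → Coord m → ℝ} (h : ∀ a, ContDiffOn ℝ ∞ (ξ a) U) :
    ContDiffOn ℝ ∞ (vecField ξ) U :=
  contDiffOn_toLp fun a => h a

theorem contDiffOn_connField (hU : IsOpen U) (h : ∀ i j, ContDiffOn ℝ ∞ (g i j) U)
    (hdet : ∀ y ∈ U, (Matrix.of fun a b => g a b y).det ≠ 0) : ContDiffOn ℝ ∞ (connField g) U :=
  contDiffOn_lin fun i => contDiffOn_lin fun j => contDiffOn_toLp fun k =>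
    contDiffOn_christoffel hU h hdet k i j

theorem christoffel_symm (hU : IsOpen U) (hs : ∀ y ∈ U, ∀ i j, g i j y = g j i y) (hy : y ∈ U)
    (k i j : Fin m) : christoffel g k i j y = christoffel g k j i y := by
  have h (l : Fin m) : partialDeriv l (g i j) y = partialDeriv l (g j i) y := by
    have : g i j =ᶠ[nhds y] g j i := by
      filter_upwards [hU.mem_nhds hy] with z hz using hs z hz i j
    rw [partialDeriv, partialDeriv, this.fderiv_eq]
  simp only [christoffel, h]
  congr 1
  refine Finset.sum_congr rfl fun l _ => ?_
  ring

theorem connField_symm (hU : IsOpen U) (hs : ∀ y ∈ U, ∀ i j, g i j y = g j i y) (hy : y ∈ U)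
    (X Y : Coord m) : connField g y X Y = connField g y Y X := by
  refine eq_of_basisVec (f := fun X => connField g y X Y) (f' := fun X => connField g y Y X)
    ⟨by simp, by simp⟩ ⟨by simp, by simp⟩ (fun i => ?_) X
  refine eq_of_basisVec (f := fun Y => connField g y (basisVec i) Y)
    (f' := fun Y => connField g y Y (basisVec i)) ⟨by simp, by simp⟩ ⟨by simp, by simp⟩
    (fun j => ?_) Y
  ext k
  rw [connField_basisVec, connField_basisVec, christoffel_symm hU hs hy]

theorem fderiv_bilinField (hg : DifferentiableAt ℝ (bilinField g) y) (a i j : Fin m) :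
    fderiv ℝ (bilinField g) y (basisVec a) (basisVec i) (basisVec j) =
      partialDeriv a (g i j) y := by
  rw [← fderiv_apply_apply hg]
  simp only [bilinField_basisVec, partialDeriv]

-- On basis vectors, the two lowered Christoffel symbols add up to the derivative of the metric
-- component; the other derivatives cancel.
set_option synthInstance.maxHeartbeats 200000 in
theorem fderiv_bilinField_eq (hU : IsOpen U) (h : ∀ i j, ContDiffOn ℝ ∞ (g i j) U)
    (hs : ∀ y ∈ U, ∀ i j, g i j y = g j i y)
    (hdet : (Matrix.of fun a b => g a b y).det ≠ 0) (hy : y ∈ U) (v X Y : Coord m) :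
    fderiv ℝ (bilinField g) y v X Y =
      bilinField g y (connField g y v X) Y + bilinField g y X (connField g y v Y) := by
  have hg : DifferentiableAt ℝ (bilinField g) y :=
    ((contDiffOn_bilinField h).contDiffAt (hU.mem_nhds hy)).differentiableAt (by simp)
  refine eq_of_basisVec (f := fun v => fderiv ℝ (bilinField g) y v X Y)
    (f' := fun v => bilinField g y (connField g y v X) Y + bilinField g y X (connField g y v Y))
    ⟨by simp, by simp⟩ ⟨by intros; simp; ring, by intros; simp; ring⟩ (fun a => ?_) v
  refine eq_of_basisVec (f := fun X => fderiv ℝ (bilinField g) y (basisVec a) X Y)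
    (f' := fun X => bilinField g y (connField g y (basisVec a) X) Y
      + bilinField g y X (connField g y (basisVec a) Y))
    ⟨by simp, by simp⟩ ⟨by intros; simp; ring, by intros; simp; ring⟩ (fun i => ?_) X
  refine eq_of_basisVec (f := fun Y => fderiv ℝ (bilinField g) y (basisVec a) (basisVec i) Y)
    (f' := fun Y => bilinField g y (connField g y (basisVec a) (basisVec i)) Y
      + bilinField g y (basisVec i) (connField g y (basisVec a) Y))
    ⟨by simp, by simp⟩ ⟨by intros; simp; ring, by intros; simp; ring⟩ (fun j => ?_) Y
  have hp (l i j : Fin m) : partialDeriv l (g i j) y = partialDeriv l (g j i) y := by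
    have : g i j =ᶠ[nhds y] g j i := by
      filter_upwards [hU.mem_nhds hy] with z hz using hs z hz i j
    rw [partialDeriv, partialDeriv, this.fderiv_eq]
  rw [fderiv_bilinField hg, bilinField_symm (hs y hy) (basisVec i),
    bilinField_connField (hs y hy) hdet, bilinField_connField (hs y hy) hdet, hp a j i]
  ring

theorem fderiv_connField (hΓ : DifferentiableAt ℝ (connField g) y) (i j k l : Fin m) :
    fderiv ℝ (connField g) y (basisVec i) (basisVec j) (basisVec k) l =
      partialDeriv i (christoffel g l j k) y := by
  have h1 : DifferentiableAt ℝ (fun z => connField g z (basisVec j) (basisVec k)) y :=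
    (hΓ.clm_apply (differentiableAt_const _)).clm_apply (differentiableAt_const _)
  have h2 := (EuclideanSpace.proj l : Coord m →L[ℝ] ℝ).hasFDerivAt.comp y h1.hasFDerivAt
  have h3 : (fun z => connField g z (basisVec j) (basisVec k) l) = christoffel g l j k := by
    ext z
    rw [connField_basisVec]
  rw [← fderiv_apply_apply hΓ, partialDeriv, ← h3]
  exact (congrArg (fun f => f (basisVec i)) h2.fderiv).symm

theorem curv_connField (hΓ : DifferentiableAt ℝ (connField g) y) (i j k l : Fin m) :
    curv (connField g) y (basisVec i) (basisVec j) (basisVec k) l = curvatureUp g i j k l y := by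
  have h (i j k : Fin m) :
      connField g y (basisVec i) (connField g y (basisVec j) (basisVec k)) l =
        ∑ a, christoffel g l i a y * christoffel g a j k y := by
    rw [map_eq_sum (f := fun X => connField g y (basisVec i) X) ⟨by simp, by simp⟩]
    simp [mul_comm]
  simp only [curv, PiLp.add_apply, PiLp.sub_apply, fderiv_connField hΓ, h, curvatureUp,
    Finset.sum_sub_distrib]
  ring

theorem curvature_eq (hΓ : DifferentiableAt ℝ (connField g) y) (i j k l : Fin m) :
    curvature g i j k l y =
      bilinField g y (curv (connField g) y (basisVec i) (basisVec j) (basisVec k))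
        (basisVec l) := by
  rw [bilinField_apply_basisVec, curvature]
  simp only [curv_connField hΓ, mul_comm]

/-- Covariant differentiation commutes with lowering an index because the connection is metric. -/
theorem covDerivTwo_eq {φ : Coord m → Coord m →L[ℝ] Coord m} {t : Fin m → Fin m → Coord m → ℝ}
    (hg : DifferentiableAt ℝ (bilinField g) y) (hφ : DifferentiableAt ℝ φ y)
    (hΓ : ∀ m X Y, fderiv ℝ (bilinField g) y m X Y =
      bilinField g y (connField g y m X) Y + bilinField g y X (connField g y m Y))
    (ht : ∀ᶠ z in nhds y, ∀ i j, t i j z = bilinField g z (φ z (basisVec i)) (basisVec j))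
    (a i j : Fin m) :
    covDerivTwo g t a i j y =
      bilinField g y (covEnd (connField g) φ y (basisVec a) (basisVec i)) (basisVec j) := by
  have h1 : DifferentiableAt ℝ (fun z => φ z (basisVec i)) y :=
    hφ.clm_apply (differentiableAt_const _)
  have h2 : t i j =ᶠ[nhds y] fun z => bilinField g z (φ z (basisVec i)) (basisVec j) :=
    ht.mono fun z hz => hz i j
  have h3 := ht.self_of_nhds
  have h4 : ∑ b, christoffel g b a i y * t b j y =
      bilinField g y (φ y (connField g y (basisVec a) (basisVec i))) (basisVec j) := by
    rw [map_eq_sum (f := fun X => bilinField g y (φ y X) (basisVec j)) ⟨by simp, by simp⟩]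
    simp [h3]
  have h5 : ∑ b, christoffel g b a j y * t i b y =
      bilinField g y (φ y (basisVec i)) (connField g y (basisVec a) (basisVec j)) := by
    rw [map_eq_sum (f := fun X => bilinField g y (φ y (basisVec i)) X) ⟨by simp, by simp⟩]
    simp [h3]
  rw [covDerivTwo, h4, h5, partialDeriv, h2.fderiv_eq, fderiv_apply (hg.clm_apply h1),
    fderiv_clm_apply hg h1]
  simp only [add_apply, ContinuousLinearMap.comp_apply, ContinuousLinearMap.flip_apply, hΓ,
    covEnd_apply, map_add, map_sub, sub_apply]
  rw [fderiv_apply hφ]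
  ring

theorem covDerivOne_eq {ξ : Coord m → Coord m} {θ : Fin m → Coord m → ℝ}
    (hg : DifferentiableAt ℝ (bilinField g) y) (hξ : DifferentiableAt ℝ ξ y)
    (hΓ : ∀ m X Y, fderiv ℝ (bilinField g) y m X Y =
      bilinField g y (connField g y m X) Y + bilinField g y X (connField g y m Y))
    (ht : ∀ᶠ z in nhds y, ∀ i, θ i z = bilinField g z (ξ z) (basisVec i)) (a j : Fin m) :
    covDerivOne g θ a j y =
      bilinField g y (covVec (connField g) ξ y (basisVec a)) (basisVec j) := by
  have h2 : θ j =ᶠ[nhds y] fun z => bilinField g z (ξ z) (basisVec j) :=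
    ht.mono fun z hz => hz j
  have h3 := ht.self_of_nhds
  have h4 : ∑ b, christoffel g b a j y * θ b y =
      bilinField g y (ξ y) (connField g y (basisVec a) (basisVec j)) := by
    rw [map_eq_sum (f := fun X => bilinField g y (ξ y) X) ⟨by simp, by simp⟩]
    simp [h3]
  rw [covDerivOne, h4, partialDeriv, h2.fderiv_eq, fderiv_apply (hg.clm_apply hξ),
    fderiv_clm_apply hg hξ]
  simp only [add_apply, ContinuousLinearMap.comp_apply, ContinuousLinearMap.flip_apply, hΓ,
    covVec_apply, map_add]
  ring

end Coord

open Coord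

/-! ### Pulling the structure on M back through a chart. -/

namespace AlmostContactMetricStructure

variable {n : ℕ} {M : Type*} [TopologicalSpace M]
  [ChartedSpace (Coord (2 * n + 1)) M] [IsManifold (𝓡 (2 * n + 1)) ∞ M]

/-- The coordinate field is the tangent map of the inverse chart applied to a constant section. -/
theorem contMDiffOn_coordVec {e : OpenPartialHomeomorph M (Coord (2 * n + 1))}
    (he : e ∈ IsManifold.maximalAtlas (𝓡 (2 * n + 1)) ∞ M) (i : Fin (2 * n + 1)) :
    ContMDiffOn 𝓘(ℝ, Coord (2 * n + 1))
      ((𝓡 (2 * n + 1)).prod 𝓘(ℝ, Coord (2 * n + 1))) ∞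
      (fun y => TotalSpace.mk' (Coord (2 * n + 1))
        (E := fun p : M => TangentSpace (𝓡 (2 * n + 1)) p)
          (e.symm y) (coordVec e i y)) e.target := by
  have h1 : ContMDiffOn 𝓘(ℝ, Coord (2 * n + 1)) (𝓡 (2 * n + 1)) ∞ e.symm e.target :=
    contMDiffOn_symm_of_mem_maximalAtlas he
  have h2 := h1.contMDiffOn_tangentMapWithin (m := ∞) (by simp) e.open_target.uniqueMDiffOn
  have h3 : ContMDiffOn 𝓘(ℝ, Coord (2 * n + 1)) (𝓘(ℝ, Coord (2 * n + 1)).tangent) ∞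
      (fun y => (⟨y, EuclideanSpace.single i (1 : ℝ)⟩ :
        TangentBundle 𝓘(ℝ, Coord (2 * n + 1)) (Coord (2 * n + 1)))) e.target :=
    fun y hy => contMDiffWithinAt_vectorSpace_iff_contDiffWithinAt.2 contDiffWithinAt_const
  refine (h2.comp h3 fun y hy => hy).congr fun y hy => ?_
  simp only [Function.comp, tangentMapWithin, coordVec]
  rw [mfderivWithin_of_isOpen e.open_target hy]

variable (S : AlmostContactMetricStructure n M) {e : OpenPartialHomeomorph M (Coord (2 * n + 1))}

omit [IsManifold (𝓡 (2 * n + 1)) ∞ M] in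
theorem contDiffOn_of_bundle {U : Set (Coord (2 * n + 1))} {b : Coord (2 * n + 1) → M}
    {f : Coord (2 * n + 1) → ℝ}
    (h : ContMDiffOn 𝓘(ℝ, Coord (2 * n + 1)) ((𝓡 (2 * n + 1)).prod 𝓘(ℝ, ℝ)) ∞
      (fun y => TotalSpace.mk' ℝ (E := Trivial M ℝ) (b y) (f y)) U) : ContDiffOn ℝ ∞ f U := by
  rw [← contMDiffOn_iff_contDiffOn]
  intro y hy
  have := h y hy
  rw [contMDiffWithinAt_totalSpace] at this
  exact this.2

theorem contDiffOn_gLow (he : e ∈ IsManifold.maximalAtlas (𝓡 (2 * n + 1)) ∞ M)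
    (i j : Fin (2 * n + 1)) : ContDiffOn ℝ ∞ (S.gLow e i j) e.target :=
  contDiffOn_of_bundle <| ContMDiffOn.clm_bundle_apply₂
    (S.g.contMDiff.comp_contMDiffOn (contMDiffOn_symm_of_mem_maximalAtlas he))
    (contMDiffOn_coordVec he i) (contMDiffOn_coordVec he j)

theorem contDiffOn_ηLow (he : e ∈ IsManifold.maximalAtlas (𝓡 (2 * n + 1)) ∞ M)
    (i : Fin (2 * n + 1)) : ContDiffOn ℝ ∞ (S.ηLow e i) e.target :=
  contDiffOn_of_bundle <| ContMDiffOn.clm_bundle_apply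
    (S.η_smooth.comp_contMDiffOn (contMDiffOn_symm_of_mem_maximalAtlas he))
    (contMDiffOn_coordVec he i)

theorem contDiffOn_φLow (he : e ∈ IsManifold.maximalAtlas (𝓡 (2 * n + 1)) ∞ M)
    (i j : Fin (2 * n + 1)) : ContDiffOn ℝ ∞ (S.φLow e i j) e.target :=
  contDiffOn_of_bundle <| ContMDiffOn.clm_bundle_apply₂
    (S.g.contMDiff.comp_contMDiffOn (contMDiffOn_symm_of_mem_maximalAtlas he))
    (ContMDiffOn.clm_bundle_apply
      (S.φ_smooth.comp_contMDiffOn (contMDiffOn_symm_of_mem_maximalAtlas he))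
      (contMDiffOn_coordVec he i)) (contMDiffOn_coordVec he j)

/-- The differential of the inverse of the chart `e` at the point with coordinates `y`. -/
def symmDeriv (e : OpenPartialHomeomorph M (Coord (2 * n + 1))) (y : Coord (2 * n + 1)) :
    Coord (2 * n + 1) →L[ℝ] TangentSpace (𝓡 (2 * n + 1)) (e.symm y) :=
  mfderiv 𝓘(ℝ, Coord (2 * n + 1)) (𝓡 (2 * n + 1)) e.symm y

/-- The differential of the chart `e` at the point with coordinates `y`. -/
def chartDeriv (e : OpenPartialHomeomorph M (Coord (2 * n + 1))) (y : Coord (2 * n + 1)) :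
    TangentSpace (𝓡 (2 * n + 1)) (e.symm y) →L[ℝ] Coord (2 * n + 1) :=
  mfderiv (𝓡 (2 * n + 1)) 𝓘(ℝ, Coord (2 * n + 1)) e (e.symm y)

omit [IsManifold (𝓡 (2 * n + 1)) ∞ M] in
theorem chartDeriv_symmDeriv
    (he : e ∈ IsManifold.maximalAtlas (𝓡 (2 * n + 1)) ∞ M)
    {y : Coord (2 * n + 1)} (hy : y ∈ e.target) (v : Coord (2 * n + 1)) :
    chartDeriv e y (symmDeriv e y v) = v := by
  have h : e.MDifferentiable (𝓡 (2 * n + 1)) 𝓘(ℝ, Coord (2 * n + 1)) :=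
    ⟨(contMDiffOn_of_mem_maximalAtlas he).mdifferentiableOn (by simp),
      (contMDiffOn_symm_of_mem_maximalAtlas he).mdifferentiableOn (by simp)⟩
  exact congrArg (fun f => f v) (h.comp_symm_deriv hy)

omit [IsManifold (𝓡 (2 * n + 1)) ∞ M] in
theorem symmDeriv_chartDeriv (he : e ∈ IsManifold.maximalAtlas (𝓡 (2 * n + 1)) ∞ M)
    {y : Coord (2 * n + 1)} (hy : y ∈ e.target) (v : TangentSpace (𝓡 (2 * n + 1)) (e.symm y)) :
    symmDeriv e y (chartDeriv e y v) = v := by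
  -- Tangent spaces are copies of the model space, so in finite dimension a one-sided inverse is
  -- two-sided.
  let A : Coord (2 * n + 1) →ₗ[ℝ] Coord (2 * n + 1) := (symmDeriv e y).toLinearMap
  let B : Coord (2 * n + 1) →ₗ[ℝ] Coord (2 * n + 1) := (chartDeriv e y).toLinearMap
  have h1 : B * A = 1 := LinearMap.ext fun v => chartDeriv_symmDeriv he hy v
  have h2 : A * B = 1 := mul_eq_one_comm.1 h1
  exact congrArg (fun f => f v) h2

variable {y : Coord (2 * n + 1)}

theorem bilinField_gLow (X Y : Coord (2 * n + 1)) :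
    bilinField (S.gLow e) y X Y = S.g.inner (e.symm y)
      (symmDeriv e y X)
      (symmDeriv e y Y) := by
  refine eq_of_basisVec (f := fun X => bilinField (S.gLow e) y X Y)
    (f' := fun X : Coord (2 * n + 1) => S.g.inner (e.symm y)
      (symmDeriv e y X)
      (symmDeriv e y Y))
    ⟨by simp, by simp⟩ ⟨fun _ _ => by rw [map_add, map_add, add_apply],
      fun _ _ => by rw [map_smul, map_smul, smul_apply]⟩ (fun i => ?_) X
  refine eq_of_basisVec (f := fun Y => bilinField (S.gLow e) y (basisVec i) Y)
    (f' := fun Y : Coord (2 * n + 1) => S.g.inner (e.symm y)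
      (symmDeriv e y (basisVec i))
      (symmDeriv e y Y))
    ⟨by simp, by simp⟩ ⟨fun _ _ => by rw [map_add, map_add],
      fun _ _ => by rw [map_smul, map_smul]⟩ (fun j => ?_) Y
  rw [bilinField_basisVec]
  rfl

theorem symmDeriv_endField (he : e ∈ IsManifold.maximalAtlas (𝓡 (2 * n + 1)) ∞ M)
    (hy : y ∈ e.target) (X : Coord (2 * n + 1)) :
    symmDeriv e y (endField (S.φUp e) y X) =
      S.φ (e.symm y) (symmDeriv e y X) := by
  rw [← symmDeriv_chartDeriv he hy (S.φ (e.symm y) _)]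
  congr 1
  refine eq_of_basisVec (f := fun X => endField (S.φUp e) y X)
    (f' := fun X : Coord (2 * n + 1) => chartDeriv e y (S.φ (e.symm y)
      (symmDeriv e y X)))
    ⟨by simp, by simp⟩ ⟨fun _ _ => ?_, fun _ _ => ?_⟩ (fun i => ?_) X
  · rw [map_add, map_add, map_add]
  · rw [map_smul, map_smul, map_smul]
  · ext a
    rw [endField_basisVec]
    rfl

theorem symmDeriv_vecField (he : e ∈ IsManifold.maximalAtlas (𝓡 (2 * n + 1)) ∞ M)
    (hy : y ∈ e.target) :
    symmDeriv e y (vecField (S.ξUp e) y) =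
      S.ξ (e.symm y) :=
  symmDeriv_chartDeriv he hy (S.ξ (e.symm y))

omit [IsManifold (𝓡 (2 * n + 1)) ∞ M] in
theorem symmDeriv_injective (he : e ∈ IsManifold.maximalAtlas (𝓡 (2 * n + 1)) ∞ M)
    (hy : y ∈ e.target) {X Y : Coord (2 * n + 1)}
    (h : symmDeriv e y X =
      symmDeriv e y Y) : X = Y := by
  rw [← chartDeriv_symmDeriv he hy X, h, chartDeriv_symmDeriv he hy Y]

theorem gLow_symm (i j : Fin (2 * n + 1)) : S.gLow e i j y = S.gLow e j i y :=
  S.g.symm _ _ _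

theorem gLow_nondeg (he : e ∈ IsManifold.maximalAtlas (𝓡 (2 * n + 1)) ∞ M)
    (hy : y ∈ e.target) (X : Coord (2 * n + 1))
    (hX : ∀ Z, bilinField (S.gLow e) y X Z = 0) : X = 0 := by
  by_contra hne
  have h1 := S.g.pos (e.symm y) (symmDeriv e y X)
    fun h => hne (symmDeriv_injective he hy (h.trans (map_zero _).symm))
  rw [← S.bilinField_gLow, hX] at h1
  exact lt_irrefl _ h1

theorem gLow_det (he : e ∈ IsManifold.maximalAtlas (𝓡 (2 * n + 1)) ∞ M)
    (hy : y ∈ e.target) : (Matrix.of fun a b => S.gLow e a b y).det ≠ 0 :=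
  det_ne_zero (S.gLow_nondeg he hy)

theorem φLow_eq (he : e ∈ IsManifold.maximalAtlas (𝓡 (2 * n + 1)) ∞ M)
    (hy : y ∈ e.target) (i j : Fin (2 * n + 1)) : S.φLow e i j y =
      bilinField (S.gLow e) y (endField (S.φUp e) y (basisVec i)) (basisVec j) := by
  rw [bilinField_gLow, symmDeriv_endField S he hy]
  rfl

theorem η_symmDeriv (he : e ∈ IsManifold.maximalAtlas (𝓡 (2 * n + 1)) ∞ M)
    (hy : y ∈ e.target) (X : Coord (2 * n + 1)) :
    S.η (e.symm y) (symmDeriv e y X) =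
      bilinField (S.gLow e) y (vecField (S.ξUp e) y) X := by
  rw [bilinField_gLow, symmDeriv_vecField S he hy, S.g_ξ]

theorem ηLow_eq (he : e ∈ IsManifold.maximalAtlas (𝓡 (2 * n + 1)) ∞ M)
    (hy : y ∈ e.target) (i : Fin (2 * n + 1)) : S.ηLow e i y =
      bilinField (S.gLow e) y (vecField (S.ξUp e) y) (basisVec i) :=
  S.η_symmDeriv he hy (basisVec i)

/-- Smoothness comes from raising an index of the smooth φ_{ib}, which avoids differentiating the
chart itself. -/
theorem contDiffOn_φUp (he : e ∈ IsManifold.maximalAtlas (𝓡 (2 * n + 1)) ∞ M)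
    (i a : Fin (2 * n + 1)) : ContDiffOn ℝ ∞ (S.φUp e i a) e.target := by
  refine (ContDiffOn.sum (s := Finset.univ) fun b _ => (contDiffOn_metricInv (S.contDiffOn_gLow he)
    (fun y hy => S.gLow_det he hy) a b).mul (S.contDiffOn_φLow he i b)).congr fun y hy => ?_
  simp only [S.φLow_eq he hy]
  rw [sum_metricInv_bilinField (fun _ _ => S.gLow_symm _ _) (S.gLow_det he hy), endField_basisVec]

theorem contDiffOn_ξUp (he : e ∈ IsManifold.maximalAtlas (𝓡 (2 * n + 1)) ∞ M)
    (a : Fin (2 * n + 1)) : ContDiffOn ℝ ∞ (S.ξUp e a) e.target := by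
  refine (ContDiffOn.sum (s := Finset.univ) fun b _ => (contDiffOn_metricInv (S.contDiffOn_gLow he)
    (fun y hy => S.gLow_det he hy) a b).mul (S.contDiffOn_ηLow he b)).congr fun y hy => ?_
  simp only [S.ηLow_eq he hy]
  rw [sum_metricInv_bilinField (fun _ _ => S.gLow_symm _ _) (S.gLow_det he hy)]
  rfl

theorem contDiffOn_metric (he : e ∈ IsManifold.maximalAtlas (𝓡 (2 * n + 1)) ∞ M) :
    ContDiffOn ℝ ∞ (bilinField (S.gLow e)) e.target :=
  contDiffOn_bilinField (S.contDiffOn_gLow he)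

theorem contDiffOn_ξField (he : e ∈ IsManifold.maximalAtlas (𝓡 (2 * n + 1)) ∞ M) :
    ContDiffOn ℝ ∞ (vecField (S.ξUp e)) e.target :=
  contDiffOn_vecField (S.contDiffOn_ξUp he)

theorem IsContactMetric.dη_field {S : AlmostContactMetricStructure n M} (hS : S.IsContactMetric)
    (he : e ∈ IsManifold.maximalAtlas (𝓡 (2 * n + 1)) ∞ M) (hy : y ∈ e.target)
    (X Y : Coord (2 * n + 1)) :
    fderiv ℝ (fun z => bilinField (S.gLow e) z (vecField (S.ξUp e) z) Y) y X -
      fderiv ℝ (fun z => bilinField (S.gLow e) z (vecField (S.ξUp e) z) X) y Y =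
    2 * bilinField (S.gLow e) y X (endField (S.φUp e) y Y) := by
  have hU := e.open_target.mem_nhds hy
  have hd : DifferentiableAt ℝ
      (fun z => bilinField (S.gLow e) z (vecField (S.ξUp e) z)) y :=
    (((S.contDiffOn_metric he).contDiffAt hU).differentiableAt (by simp)).clm_apply
      (((S.contDiffOn_ξField he).contDiffAt hU).differentiableAt (by simp))
  have hη (i j : Fin (2 * n + 1)) : fderiv ℝ (fun z => bilinField (S.gLow e) z
      (vecField (S.ξUp e) z)) y (basisVec i) (basisVec j) = partialDeriv i (S.ηLow e j) y := by
    rw [← fderiv_apply hd, partialDeriv]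
    congr 1
    refine Filter.EventuallyEq.fderiv_eq ?_
    filter_upwards [hU] with z hz using (S.ηLow_eq he hz j).symm
  rw [fderiv_apply hd, fderiv_apply hd]
  refine eq_of_basisVec
    (f := fun X => fderiv ℝ (fun z => bilinField (S.gLow e) z (vecField (S.ξUp e) z)) y X Y -
      fderiv ℝ (fun z => bilinField (S.gLow e) z (vecField (S.ξUp e) z)) y Y X)
    (f' := fun X => 2 * bilinField (S.gLow e) y X (endField (S.φUp e) y Y))
    ⟨by intros; simp; ring, by intros; simp; ring⟩ ⟨by intros; simp; ring, by intros; simp; ring⟩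
    (fun i => ?_) X
  refine eq_of_basisVec
    (f := fun Y => fderiv ℝ (fun z => bilinField (S.gLow e) z (vecField (S.ξUp e) z)) y
      (basisVec i) Y - fderiv ℝ (fun z => bilinField (S.gLow e) z (vecField (S.ξUp e) z)) y Y
      (basisVec i))
    (f' := fun Y => 2 * bilinField (S.gLow e) y (basisVec i) (endField (S.φUp e) y Y))
    ⟨by intros; simp; ring, by intros; simp; ring⟩ ⟨by intros; simp; ring, by intros; simp; ring⟩
    (fun j => ?_) Y
  have h1 := hS.dη_eq e he y hy i j
  rw [hη, hη, bilinField_gLow, symmDeriv_endField S he hy]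
  rw [extDerivOne] at h1
  change _ = 2 * S.g.inner (e.symm y) (coordVec e i y) (S.φ (e.symm y) (coordVec e j y))
  rw [← h1]
  ring

/-- A contact metric structure in local coordinates. -/
theorem IsContactMetric.isLocalContactMetric {S : AlmostContactMetricStructure n M}
    (hS : S.IsContactMetric) (he : e ∈ IsManifold.maximalAtlas (𝓡 (2 * n + 1)) ∞ M) :
    IsLocalContactMetric e.target (bilinField (S.gLow e)) (connField (S.gLow e))
      (endField (S.φUp e)) (vecField (S.ξUp e)) where
  isOpen := e.open_target
  contDiff_g := S.contDiffOn_metric he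
  contDiff_Γ := contDiffOn_connField e.open_target (S.contDiffOn_gLow he)
    fun y hy => S.gLow_det he hy
  contDiff_φ := contDiffOn_endField (S.contDiffOn_φUp he)
  contDiff_ξ := S.contDiffOn_ξField he
  symm y hy := bilinField_symm fun _ _ => S.gLow_symm _ _
  nondeg y hy := S.gLow_nondeg he hy
  Γ_symm y hy := connField_symm e.open_target (fun _ _ _ _ => S.gLow_symm _ _) hy
  Γ_metric y hy := fderiv_bilinField_eq e.open_target (S.contDiffOn_gLow he)
    (fun _ _ _ _ => S.gLow_symm _ _) (S.gLow_det he hy) hy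
  φφ y hy X := symmDeriv_injective he hy <| by
    rw [symmDeriv_endField S he hy, symmDeriv_endField S he hy, S.φ_φ, map_add, map_neg, map_smul,
      symmDeriv_vecField S he hy, S.η_symmDeriv he hy]
  φξ y hy := symmDeriv_injective he hy <| by
    rw [symmDeriv_endField S he hy, symmDeriv_vecField S he hy, S.φ_ξ, map_zero]
  ξξ y hy := by rw [← S.η_symmDeriv he hy, symmDeriv_vecField S he hy, S.η_ξ]
  skew y hy X Y := by
    rw [bilinField_gLow, bilinField_gLow, symmDeriv_endField S he hy, symmDeriv_endField S he hy]
    -- Skewness of φ is compatibility of g applied to X and φY, with φ² expanded and η∘φ = 0.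
    have h1 := S.g_φ_φ (e.symm y)
      (symmDeriv e y X)
      (S.φ (e.symm y) (symmDeriv e y Y))
    rw [S.η_φ, S.φ_φ, map_add, map_neg, map_smul, S.g.symm _ (S.φ _ _) (S.ξ _), ← S.g_ξ, S.η_φ]
      at h1
    rw [smul_zero, add_zero, mul_zero, sub_zero] at h1
    linarith
  dη y hy := hS.dη_field he hy

end AlmostContactMetricStructure

/-! ### Contractions over indices as values of multilinear maps. -/

namespace Coord

variable {m : ℕ} {F : Type*} [NormedAddCommGroup F] [NormedSpace ℝ F]

theorem sum_coord_mul {f : Coord m → ℝ} (hf : IsLinearMap ℝ f) (v : Coord m) :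
    ∑ a, v a * f (basisVec a) = f v := by
  simp only [map_eq_sum hf v, smul_eq_mul]

theorem sum_coord_mul₂ {f : Coord m → Coord m → ℝ} (h₁ : ∀ Y, IsLinearMap ℝ fun X => f X Y)
    (h₂ : ∀ X, IsLinearMap ℝ (f X)) (u v : Coord m) :
    ∑ a, ∑ b, u a * v b * f (basisVec a) (basisVec b) = f u v := by
  simp only [mul_assoc, ← Finset.mul_sum, sum_coord_mul (h₂ _)]
  exact sum_coord_mul (h₁ v) u

theorem sum_coord_mul₄ {f : Coord m → Coord m → Coord m → Coord m → ℝ}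
    (h₁ : ∀ Y Z W, IsLinearMap ℝ fun X => f X Y Z W)
    (h₂ : ∀ X Z W, IsLinearMap ℝ fun Y => f X Y Z W)
    (h₃ : ∀ X Y W, IsLinearMap ℝ fun Z => f X Y Z W)
    (h₄ : ∀ X Y Z, IsLinearMap ℝ (f X Y Z)) (u v w x : Coord m) :
    ∑ a, ∑ b, ∑ c, ∑ d, u a * v b * w c * x d *
      f (basisVec a) (basisVec b) (basisVec c) (basisVec d) = f u v w x := by
  rw [← sum_coord_mul₂ (f := fun X Y => f X Y w x) (fun _ => h₁ _ _ _) (fun _ => h₂ _ _ _)]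
  refine Finset.sum_congr rfl fun a _ => Finset.sum_congr rfl fun b _ => ?_
  rw [← sum_coord_mul₂ (f := fun Z W => f (basisVec a) (basisVec b) Z W) (fun _ => h₃ _ _ _)
    (fun _ => h₄ _ _ _)]
  simp only [Finset.mul_sum, mul_assoc]

end Coord

namespace LocalConnection

variable {E : Type*} [NormedAddCommGroup E] [NormedSpace ℝ E]
  (g : E →L[ℝ] E →L[ℝ] ℝ) (Γ : E → E →L[ℝ] E →L[ℝ] E) (y : E)

set_option synthInstance.maxHeartbeats 200000 in
theorem isLinearMap_curv₁ (Y Z W : E) : IsLinearMap ℝ fun X => g (curv Γ y X Y Z) W := by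
  have h₁ (X X' : E) : fderiv ℝ Γ y (X + X') Y Z = fderiv ℝ Γ y X Y Z + fderiv ℝ Γ y X' Y Z := by
    rw [(fderiv ℝ Γ y).map_add]; rfl
  have h₂ (c : ℝ) (X : E) : fderiv ℝ Γ y (c • X) Y Z = c • fderiv ℝ Γ y X Y Z := by
    rw [(fderiv ℝ Γ y).map_smul]; rfl
  -- The derivative is hidden behind an opaque map, so that only its linearity, `h₁` and `h₂`,
  -- enters the simplification.
  obtain ⟨B, hB⟩ : ∃ B : E → E, ∀ X, fderiv ℝ Γ y X Y Z = B X := ⟨_, fun _ => rfl⟩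
  simp only [hB] at h₁ h₂
  simp only [curv, hB]
  generalize fderiv ℝ Γ y Y = A
  exact ⟨by intros; simp [h₁]; ring, by intros; simp [h₂]; ring⟩

theorem isLinearMap_curv₂ (X Z W : E) : IsLinearMap ℝ fun Y => g (curv Γ y X Y Z) W := by
  have h (Y : E) : g (curv Γ y X Y Z) W = -g (curv Γ y Y X Z) W := by
    rw [← neg_apply, ← map_neg]
    simp only [curv]
    congr 3
    abel
  simp only [h]
  exact ⟨fun _ _ => by rw [(isLinearMap_curv₁ g Γ y X Z W).map_add, neg_add],
    fun _ _ => by rw [(isLinearMap_curv₁ g Γ y X Z W).map_smul, smul_neg]⟩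

theorem isLinearMap_curv₃ (X Y W : E) : IsLinearMap ℝ fun Z => g (curv Γ y X Y Z) W := by
  simp only [curv]
  generalize fderiv ℝ Γ y X Y = A
  generalize fderiv ℝ Γ y Y X = B
  exact ⟨by intros; simp; ring, by intros; simp; ring⟩

theorem isLinearMap_curv₄ (X Y Z : E) : IsLinearMap ℝ fun W => g (curv Γ y X Y Z) W :=
  ⟨by simp, by simp⟩

end LocalConnection

/-! ### Assembly in local coordinates. -/

theorem corollary1 (n : ℕ) {M : Type*} [TopologicalSpace M]
    [ChartedSpace (Coord (2 * n + 1)) M] [IsManifold (𝓡 (2 * n + 1)) ∞ M]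
    (S : AlmostContactMetricStructure n M) (hS : S.IsContactMetric)
    (e : OpenPartialHomeomorph M (Coord (2 * n + 1)))
    (he : e ∈ IsManifold.maximalAtlas (𝓡 (2 * n + 1)) ∞ M)
    (y : Coord (2 * n + 1)) (hy : y ∈ e.target) :
    (∀ i j k l : Fin (2 * n + 1),
      S.R e i j k l y
        + (∑ a, ∑ b, ∑ c, ∑ d,
            S.φUp e i a y * S.φUp e j b y * S.φUp e k c y * S.φUp e l d y * S.R e a b c d y)
        + (∑ a, ∑ c, S.φUp e i a y * S.φUp e k c y * S.R e a j c l y)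
        + (∑ b, ∑ d, S.φUp e j b y * S.φUp e l d y * S.R e i b k d y)
        - (∑ a, ∑ b, S.φUp e i a y * S.φUp e j b y * S.R e a b k l y)
        - (∑ c, ∑ d, S.φUp e k c y * S.φUp e l d y * S.R e i j c d y)
        + (∑ a, ∑ d, S.φUp e i a y * S.φUp e l d y * S.R e a j k d y)
        + (∑ b, ∑ c, S.φUp e j b y * S.φUp e k c y * S.R e i b c l y)
        + 4 * S.φLow e i l y * S.φLow e j k y
        - 4 * S.φLow e j l y * S.φLow e i k y
        - 4 * S.gLow e i l y * S.gLow e j k y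
        + 4 * S.gLow e j l y * S.gLow e i k y
        + 4 * S.gLow e i l y * S.ηLow e j y * S.ηLow e k y
        + 4 * S.gLow e j k y * S.ηLow e i y * S.ηLow e l y
        - 4 * S.gLow e j l y * S.ηLow e i y * S.ηLow e k y
        - 4 * S.gLow e i k y * S.ηLow e j y * S.ηLow e l y
      = 2 * (∑ a, S.nablaUpφ e a i j y * S.nablaφ e a k l y)
        + 2 * S.ηLow e k y * S.nablaφ e l i j y
        - 2 * S.ηLow e l y * S.nablaφ e k i j y
        + 2 * S.ηLow e i y * S.nablaφ e j k l y
        - 2 * S.ηLow e j y * S.nablaφ e i k l y) ∧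
    (∀ j k l : Fin (2 * n + 1),
      (∑ a, ∑ b, ∑ c, ∑ d,
          S.ξUp e a y * S.φUp e j b y * S.φUp e k c y * S.φUp e l d y * S.R e a b c d y)
        + (∑ a, ∑ c, S.ξUp e a y * S.φUp e k c y * S.R e a j c l y)
        - (∑ a, ∑ b, S.ξUp e a y * S.φUp e j b y * S.R e a b k l y)
        + (∑ a, ∑ d, S.ξUp e a y * S.φUp e l d y * S.R e a j k d y)
      = 2 * (∑ a, S.nablaUpη e a j y * S.nablaφ e a k l y)
        + 2 * S.ηLow e k y * S.nablaη e l j y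
        - 2 * S.ηLow e l y * S.nablaη e k j y
        + 2 * (∑ a, S.φLow e a j y * S.nablaUpφ e a k l y)) ∧
    (∀ i k : Fin (2 * n + 1),
      (∑ a, ∑ b, ∑ c, ∑ d,
          S.φUp e i a y * S.ξUp e b y * S.φUp e k c y * S.ξUp e d y * S.R e a b c d y)
        + (∑ b, ∑ d, S.ξUp e b y * S.ξUp e d y * S.R e i b k d y)
      = 2 * ((∑ a, S.nablaη e a i y * S.nablaUpη e a k y)
        + (∑ a, S.φLow e a k y * S.nablaUpη e a i y)
        + (∑ a, S.φLow e a i y * S.nablaUpη e a k y))) := by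
  
  have hL := hS.isLocalContactMetric he
  have h := hL.isContactTwoJet hy
  have hs : ∀ i j, S.gLow e i j y = S.gLow e j i y := fun _ _ => S.gLow_symm _ _
  have hdet := S.gLow_det he hy
  have hg : DifferentiableAt ℝ (bilinField (S.gLow e)) y :=
    (hL.contDiffAt_g hy).differentiableAt (by simp)
  have hR (i j k l : Fin (2 * n + 1)) : S.R e i j k l y = bilinField (S.gLow e) y
      (curv (connField (S.gLow e)) y (basisVec i) (basisVec j) (basisVec k)) (basisVec l) :=
    curvature_eq ((hL.contDiffAt_Γ hy).differentiableAt (by simp)) i j k l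
  have hφ (a i j : Fin (2 * n + 1)) : S.nablaφ e a i j y = bilinField (S.gLow e) y
      (covEnd (connField (S.gLow e)) (endField (S.φUp e)) y (basisVec a) (basisVec i))
      (basisVec j) :=
    covDerivTwo_eq hg (hL.diff_φ hy) (hL.Γ_metric y hy)
      ((hL.eventually hy).mono fun z hz => S.φLow_eq he hz) a i j
  have hη (a j : Fin (2 * n + 1)) : S.nablaη e a j y = bilinField (S.gLow e) y
      (covVec (connField (S.gLow e)) (vecField (S.ξUp e)) y (basisVec a)) (basisVec j) :=
    covDerivOne_eq hg ((hL.contDiffAt_ξ hy).differentiableAt (by simp)) (hL.Γ_metric y hy)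
      ((hL.eventually hy).mono fun z hz => S.ηLow_eq he hz) a j
  have hgl (i j : Fin (2 * n + 1)) : S.gLow e i j y =
      bilinField (S.gLow e) y (basisVec i) (basisVec j) := by rw [bilinField_basisVec]
  set g := bilinField (S.gLow e) y with hgdef
  set φ := endField (S.φUp e) y with hφdef
  set ξ := vecField (S.ξUp e) y with hξdef
  set t := covEnd (connField (S.gLow e)) (endField (S.φUp e)) y with htdef
  set N := covVec (connField (S.gLow e)) (vecField (S.ξUp e)) y with hNdef
  set K := curv (connField (S.gLow e)) y with hKdef
  have hφc (i a : Fin (2 * n + 1)) : S.φUp e i a y = φ (basisVec i) a :=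
    (endField_basisVec _ _ _ _).symm
  have hξc (a : Fin (2 * n + 1)) : S.ξUp e a y = ξ a := rfl
  have hφl : ∀ i j, S.φLow e i j y = g (φ (basisVec i)) (basisVec j) := S.φLow_eq he hy
  have hηl : ∀ i, S.ηLow e i y = g ξ (basisVec i) := S.ηLow_eq he hy
  -- `t_eq` exhibits the raised derivative as a vector; for η, the transpose of N plays this role.
  have hφUp (a i j : Fin (2 * n + 1)) : S.nablaUpφ e a i j y =
      (t (basisVec j) (basisVec i) - t (basisVec i) (basisVec j)) a := by
    rw [← sum_metricInv_bilinField hs hdet, AlmostContactMetricStructure.nablaUpφ]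
    refine Finset.sum_congr rfl fun b _ => ?_
    rw [hφ, h.t_eq, h.symm]
    rfl
  have hηUp (a j : Fin (2 * n + 1)) : S.nablaUpη e a j y =
      (N (basisVec j) + (2 : ℝ) • φ (basisVec j)) a := by
    rw [← sum_metricInv_bilinField hs hdet, AlmostContactMetricStructure.nablaUpη]
    refine Finset.sum_congr rfl fun b _ => ?_
    rw [hη, h.symm, h.N_transpose]
    rfl
  have hK1 := isLinearMap_curv₁ g (connField (S.gLow e)) y
  have hK2 := isLinearMap_curv₂ g (connField (S.gLow e)) y
  have hK3 := isLinearMap_curv₃ g (connField (S.gLow e)) y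
  have hK4 := isLinearMap_curv₄ g (connField (S.gLow e)) y
  rw [← hKdef] at hK1 hK2 hK3 hK4
  have h4 := sum_coord_mul₄ (f := fun X Y Z W => g (K X Y Z) W) hK1 hK2 hK3 hK4
  have h12 (c d) := sum_coord_mul₂ (f := fun X Y => g (K X Y c) d) (fun _ => hK1 _ _ _)
    (fun _ => hK2 _ _ _)
  have h13 (b d) := sum_coord_mul₂ (f := fun X Z => g (K X b Z) d) (fun _ => hK1 _ _ _)
    (fun _ => hK3 _ _ _)
  have h14 (b c) := sum_coord_mul₂ (f := fun X W => g (K X b c) W) (fun _ => hK1 _ _ _)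
    (fun _ => hK4 _ _ _)
  have h23 (a d) := sum_coord_mul₂ (f := fun Y Z => g (K a Y Z) d) (fun _ => hK2 _ _ _)
    (fun _ => hK3 _ _ _)
  have h24 (a c) := sum_coord_mul₂ (f := fun Y W => g (K a Y c) W) (fun _ => hK2 _ _ _)
    (fun _ => hK4 _ _ _)
  have h34 (a b) := sum_coord_mul₂ (f := fun Z W => g (K a b Z) W) (fun _ => hK3 _ _ _)
    (fun _ => hK4 _ _ _)
  refine ⟨fun i j k l => ?_, fun j k l => ?_, fun i k => ?_⟩
  · have hT : ∑ a, S.nablaUpφ e a i j y * S.nablaφ e a k l y =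
        g (t (basisVec j) (basisVec i) - t (basisVec i) (basisVec j))
          (t (basisVec l) (basisVec k) - t (basisVec k) (basisVec l)) := by
      simp only [hφUp, hφ, h.t_eq (basisVec _) (basisVec k)]
      exact sum_coord_mul (f := fun X => g X _) ⟨by simp, by simp⟩ _
    rw [hT]
    simp only [hR, hφc, hφ, hφl, hgl, hηl, h4, h12, h13, h14, h23, h24, h34]
    exact h.curvature_identity (basisVec i) (basisVec j) (basisVec k) (basisVec l)
  · have hT : ∑ a, S.nablaUpη e a j y * S.nablaφ e a k l y =
        g (t (N (basisVec j) + (2 : ℝ) • φ (basisVec j)) (basisVec k)) (basisVec l) := by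
      simp only [hηUp, hφ]
      exact sum_coord_mul (f := fun X => g (t X _) _) ⟨by simp, by simp⟩ _
    -- The minus sign comes from moving φ across g; `t_eq` then makes φ∂_j the direction of
    -- differentiation.
    have hT' : ∑ a, S.φLow e a j y * S.nablaUpφ e a k l y =
        -g (t (φ (basisVec j)) (basisVec k)) (basisVec l) := by
      simp only [hφUp, hφl, mul_comm (g _ _)]
      rw [sum_coord_mul (f := fun X => g (φ X) (basisVec j)) ⟨by simp, by simp⟩, h.skew, h.t_eq,
        h.symm]
    rw [hT, hT']
    simp only [hR, hφc, hξc, hη, hηl, h4, h12, h13, h14]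
    linear_combination h.curvature_identity_ξ (basisVec j) (basisVec k) (basisVec l)
  · have hT : ∑ a, S.nablaη e a i y * S.nablaUpη e a k y =
        g (N (basisVec i) + (2 : ℝ) • φ (basisVec i))
          (N (basisVec k) + (2 : ℝ) • φ (basisVec k)) := by
      simp only [hηUp, hη, mul_comm (g _ _)]
      rw [sum_coord_mul (f := fun X => g (N X) (basisVec i)) ⟨by simp, by simp⟩, h.symm,
        h.N_transpose]
    have hT' (i k : Fin (2 * n + 1)) : ∑ a, S.φLow e a k y * S.nablaUpη e a i y =
        -g (N (basisVec i) + (2 : ℝ) • φ (basisVec i)) (φ (basisVec k)) := by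
      simp only [hηUp, hφl, mul_comm (g _ _)]
      rw [sum_coord_mul (f := fun X => g (φ X) (basisVec k)) ⟨by simp, by simp⟩, h.skew]
    rw [hT, hT', hT']
    simp only [hR, hφc, hξc, h4, h24]
    rw [h.symm _ (φ (basisVec i))]
    linear_combination h.curvature_identity_ξ_ξ (basisVec i) (basisVec k)

end
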